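/- All graphs are labelled and all identities are between formal power series with rational coefficients. A multigraph may have loops and multiple edges; a loop contributes two to the degree of its vertex. A $k$-multigraph is a connected multigraph in which every vertex has degree at least $k$; a 3-graph is a connected simple graph with minimum degree at least three. (The empty graph is not connected.) If $\alpha_i$ is the number of vertices of a multigraph $\widetilde G$ incident to exactly $i$ loops, and $\beta_i$ is the number of its $i$-edges (pairs of distinct vertices joined by exactly $i$ edges), the weight of $\widetilde G$ is $$w(\widetilde G)=\prod_{i\ge1}\Big(\frac1{2^i\,i!}\Big)^{\alpha_i}\prod_{i\ge1}\Big(\frac1{i!}\Big)^{\beta_i}.$$ Let $\widetilde C_{n,m,l_1,l_2,\ldots}$ (respectively $\widetilde K_{n,m,l_1,l_2,\ldots}$) be the sum of the weights of the connected multigraphs (respectively 3-multigraphs) with $n$ vertices, $m$ loops and $l_i$ $i$-edges for each $i\ge1$, and let $$\widetilde C(x,z,y_1,y_2,\ldots)=\sum \widetilde C_{n,m,l_1,l_2,\ldots}\frac{x^n}{n!}z^m y_1^{l_1}y_2^{l_2}\cdots,\qquad \widetilde K(x,z,y_1,y_2,\ldots)=\sum \widetilde K_{n,m,l_1,l_2,\ldots}\frac{x^n}{n!}z^m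 y_1^{l_1}y_2^{l_2}\cdots .$$ Let $C(x,y)=\sum C_{n,m}\frac{x^n}{n!}y^m$ and $K(x,y)=\sum K_{n,m}\frac{x^n}{n!}y^m$, where $C_{n,m}$ and $K_{n,m}$ are the numbers of connected simple graphs and of 3-graphs with $n$ vertices and $m$ edges. Put $$E(x,y)=-x+\frac{x^2y}{2+2xy}-\ln\sqrt{1+xy}+\frac{xy}2-\frac{(xy)^2}4 .$$ (1) With $y_0=1$ and $s=-\dfrac{xy_1^2}{1+xy_1}$, $$\widetilde K(x,z,y_1,y_2,\ldots)=\widetilde C\Big(xe^{-x(y_1+s)},\,-sxy_1-xy_2+z,\,s+y_1,\,s^2+2y_1s+y_2,\,\ldots,\,\sum_{j=0}^k\binom kj y_js^{k-j},\,\ldots\Big)+E(x,y_1)-\frac{xz}2+\frac{x^2y_2}4,$$ where $y_k$ is replaced by $\sum_{j=0}^k\binom kj y_js^{k-j}$ for every $k\ge1$, and this substitution is well defined on formal power series. (2) With $$A(x,y)=x\,e^{(x^2y^3-2xy)/(2+2xy)},\qquad B(x,y)=(y+1)\,e^{-xy^2/(1+xy)}-1,$$ $$K(x,y)=C\big(A(x,y),B(x,y)\big)+E(x,y),$$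 and this substitution is well defined on formal power series. -/

import Mathlib

namespace KernelEGF

/-! ### Simple graphs -/

/-- `simpleGF k` is the exponential generating function `∑ g_{n,m} x ^ n y ^ m / n!`, where
`g_{n,m}` is the number of connected simple graphs on the labelled vertex set `Fin n` with `m`
edges in which every vertex has degree at least `k`. The variables are `x = X 0`, `y = X 1`. -/
noncomputable def simpleGF (k : ℕ) : MvPowerSeries (Fin 2) ℚ := fun d =>
  (Nat.card {G : SimpleGraph (Fin (d 0)) //
    G.Connected ∧ (∀ v, k ≤ (G.neighborSet v).ncard) ∧ G.edgeSet.ncard = d 1} : ℚ)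
    / ((d 0).factorial : ℚ)

/-- The generating function `C(x, y)` of connected graphs. -/
noncomputable def connectedGF : MvPowerSeries (Fin 2) ℚ := simpleGF 0

/-- The generating function `K(x, y)` of 3-graphs (connected graphs of minimum degree
at least three). -/
noncomputable def threeGraphGF : MvPowerSeries (Fin 2) ℚ := simpleGF 3

/-! ### Multigraphs -/

/-- A multigraph on the labelled vertex set `V`: the multiplicity of every unordered pair of
vertices; `G s(v, v)` is the number of loops at `v`. -/
abbrev Multigraph (V : Type) : Type := Sym2 V → ℕ

namespace Multigraph

variable {V : Type}

/-- The underlying simple graph: loops are removed, multiple edges become simple. -/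
def toSimple (G : Multigraph V) : SimpleGraph V where
  Adj u v := u ≠ v ∧ G s(u, v) ≠ 0
  symm := ⟨fun u v h => ⟨h.1.symm, by rw [Sym2.eq_swap]; exact h.2⟩⟩
  loopless := ⟨fun _ h => h.1 rfl⟩

/-- The degree of a vertex; a loop contributes two. -/
def degree [Fintype V] (G : Multigraph V) (v : V) : ℕ :=
  (∑ u, G s(v, u)) + G s(v, v)

/-- A `k`-multigraph: connected, and every vertex has degree at least `k`. The `0`-multigraphs
are the connected multigraphs. -/
def IsKMultigraph [Fintype V] (k : ℕ) (G : Multigraph V) : Prop :=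
  G.toSimple.Connected ∧ ∀ v, k ≤ G.degree v

/-- The total number of loops. -/
def numLoops [Fintype V] (G : Multigraph V) : ℕ := ∑ v, G s(v, v)

/-- `α_i`: the number of vertices which are incident to exactly `i` loops. -/
def loopVertices [Fintype V] (G : Multigraph V) (i : ℕ) : ℕ :=
  (Finset.univ.filter fun v => G s(v, v) = i).card

/-- `β_i`: the number of `i`-edges, i.e. of pairs of distinct vertices that are joined by
exactly `i` edges (used for `i ≥ 1`). -/
def numEdges [Fintype V] [DecidableEq V] (G : Multigraph V) (i : ℕ) : ℕ :=
  (Finset.univ.filter fun e : Sym2 V => ¬ e.IsDiag ∧ G e = i).card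

/-- The weight: a factor `1 / (2 ^ i * i!)` for every vertex with exactly `i` loops and a factor
`1 / i!` for every `i`-edge (these factors are `1` for `i = 0`). -/
def weight [Fintype V] [DecidableEq V] (G : Multigraph V) : ℚ :=
  (∏ v, 1 / ((2 : ℚ) ^ G s(v, v) * ((G s(v, v)).factorial : ℚ))) *
    ∏ e : Sym2 V with ¬ e.IsDiag, 1 / ((G e).factorial : ℚ)

/-- The weight in the form `∏_{i ≥ 1} (1 / (2 ^ i i!)) ^ α_i * ∏_{i ≥ 1} (1 / i!) ^ β_i`, with the
products truncated at any bound on the multiplicities. -/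
theorem weight_eq [Fintype V] [DecidableEq V] (G : Multigraph V) (N : ℕ) (hN : ∀ e, G e ≤ N) :
    G.weight = (∏ i ∈ Finset.Icc 1 N, (1 / ((2 : ℚ) ^ i * (i.factorial : ℚ))) ^ G.loopVertices i) *
      ∏ i ∈ Finset.Icc 1 N, (1 / (i.factorial : ℚ)) ^ G.numEdges i := by
  have key : ∀ f : ℕ → ℚ, f 0 = 1 → ∏ i ∈ Finset.Icc 1 N, f i = ∏ i ∈ Finset.range (N + 1), f i := by
    intro f hf
    rw [Finset.prod_range_succ', hf, mul_one, Finset.range_eq_Ico,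
      Finset.prod_Ico_add' f 0 N 1]
    rfl
  rw [key _ (by simp), key _ (by simp), weight]
  congr 1
  · rw [← Finset.prod_fiberwise_of_maps_to (s := Finset.univ) (t := Finset.range (N + 1))
      (g := fun v => G s(v, v)) (fun v _ => Finset.mem_range.2 (Nat.lt_succ_of_le (hN _)))]
    refine Finset.prod_congr rfl fun i _ => ?_
    rw [loopVertices, ← Finset.prod_const]
    refine Finset.prod_congr rfl fun v hv => ?_
    rw [(Finset.mem_filter.1 hv).2]
  · rw [← Finset.prod_fiberwise_of_maps_to (t := Finset.range (N + 1))
      (g := G) (fun v _ => Finset.mem_range.2 (Nat.lt_succ_of_le (hN _)))]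
    refine Finset.prod_congr rfl fun i _ => ?_
    rw [numEdges, ← Finset.prod_const, Finset.filter_filter]
    refine Finset.prod_congr rfl fun v hv => ?_
    rw [(Finset.mem_filter.1 hv).2.2]

end Multigraph

/-- The variables `x` (vertices), `z` (loops) and `y i` (`i`-edges, `i ≥ 1`). -/
inductive Var : Type
  | x : Var
  | z : Var
  | y (i : ℕ+) : Var

/-- The `k`-multigraphs on `Fin n`, `n = d x`, with `d z` loops and `d (y i)` `i`-edges for
each `i ≥ 1`. -/
def multigraphsWith (k : ℕ) (d : Var →₀ ℕ) : Set (Multigraph (Fin (d Var.x))) :=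
  {G | G.IsKMultigraph k ∧ G.numLoops = d Var.z ∧ ∀ i : ℕ+, G.numEdges i = d (Var.y i)}

theorem finite_multigraphsWith (k : ℕ) (d : Var →₀ ℕ) : (multigraphsWith k d).Finite := by
  classical
  obtain ⟨N, hN⟩ : ∃ N, ∀ i : ℕ+, d (Var.y i) ≠ 0 → (i : ℕ) ≤ N := by
    refine ⟨d.support.sup fun v => match v with
      | Var.y i => (i : ℕ)
      | _ => 0, fun i hi => ?_⟩
    exact Finset.le_sup (f := fun v => match v with
      | Var.y i => (i : ℕ)
      | _ => 0) (Finsupp.mem_support_iff.2 hi)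
  refine (Set.Finite.pi' (t := fun _ => Set.Iic (N + d Var.z))
    fun _ => Set.finite_Iic _).subset ?_
  rintro G ⟨-, hl, he⟩ e
  change G e ≤ N + d Var.z
  by_cases hd : e.IsDiag
  · induction e with | _ u v
    obtain rfl : u = v := hd
    have : G s(u, u) ≤ Multigraph.numLoops G :=
      Finset.single_le_sum (f := fun v => G s(v, v)) (fun _ _ => Nat.zero_le _)
        (Finset.mem_univ u)
    omega
  · rcases Nat.eq_zero_or_pos (G e) with h0 | h0
    · omega
    · have h1 : d (Var.y (⟨G e, h0⟩ : ℕ+)) ≠ 0 := by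
        refine (he (⟨G e, h0⟩ : ℕ+)).symm.trans_ne ?_
        exact Finset.card_ne_zero_of_mem (Finset.mem_filter.2 ⟨Finset.mem_univ e, hd, rfl⟩)
      have := hN _ h1
      simp only [PNat.mk_coe] at this
      omega

/-- `multiGF k` is the generating function
`∑ G_{n,m,l₁,l₂,…} x ^ n z ^ m y₁ ^ l₁ y₂ ^ l₂ ⋯ / n!`, where `G_{n,m,l₁,l₂,…}` is the sum of the
weights of the `k`-multigraphs with `n` labelled vertices, `m` loops and `l_i` `i`-edges. -/
noncomputable def multiGF (k : ℕ) : MvPowerSeries Var ℚ := fun d =>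
  (∑ G ∈ (finite_multigraphsWith k d).toFinset, G.weight) / ((d Var.x).factorial : ℚ)

/-- The generating function of (weighted) connected multigraphs. -/
noncomputable def connectedMultiGF : MvPowerSeries Var ℚ := multiGF 0

/-- The generating function of (weighted) 3-multigraphs. -/
noncomputable def threeMultiGF : MvPowerSeries Var ℚ := multiGF 3

/-! ### The explicit series -/

/-- `exp f`, for a formal power series `f` without constant term. -/
noncomputable def expS {σ : Type} (f : MvPowerSeries σ ℚ) : MvPowerSeries σ ℚ :=
  (PowerSeries.exp ℚ).subst f

/-- `ln (1 + f)`, for a formal power series `f` without constant term. -/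
noncomputable def logOneAdd {σ : Type} (f : MvPowerSeries σ ℚ) : MvPowerSeries σ ℚ :=
  (PowerSeries.log ℚ).subst f

/-- `E(x, y) = -x + x²y / (2 + 2xy) - ln √(1 + xy) + xy / 2 - (xy)² / 4`. -/
noncomputable def serE {σ : Type} (x y : MvPowerSeries σ ℚ) : MvPowerSeries σ ℚ :=
  -x + x ^ 2 * y * (2 + 2 * x * y)⁻¹ - (1 / 2 : ℚ) • logOneAdd (x * y)
    + (1 / 2 : ℚ) • (x * y) - (1 / 4 : ℚ) • (x * y) ^ 2

/-- `A(x, y) = x exp ((x²y³ - 2xy) / (2 + 2xy))`. -/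
noncomputable def serA {σ : Type} (x y : MvPowerSeries σ ℚ) : MvPowerSeries σ ℚ :=
  x * expS ((x ^ 2 * y ^ 3 - 2 * x * y) * (2 + 2 * x * y)⁻¹)

/-- `B(x, y) = (y + 1) exp (-xy² / (1 + xy)) - 1`. -/
noncomputable def serB {σ : Type} (x y : MvPowerSeries σ ℚ) : MvPowerSeries σ ℚ :=
  (y + 1) * expS (-(x * y ^ 2) * (1 + x * y)⁻¹) - 1

/-- The variable `x` of the multigraph series. -/
noncomputable def varX : MvPowerSeries Var ℚ := MvPowerSeries.X Var.x

/-- The variable `z` of the multigraph series. -/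
noncomputable def varZ : MvPowerSeries Var ℚ := MvPowerSeries.X Var.z

/-- The variables `y_j` of the multigraph series, with the convention `y_0 = 1`. -/
noncomputable def varY : ℕ → MvPowerSeries Var ℚ
  | 0 => 1
  | j + 1 => MvPowerSeries.X (Var.y j.succPNat)

/-- `s = -x y₁² / (1 + x y₁)`. -/
noncomputable def serS : MvPowerSeries Var ℚ :=
  -(varX * varY 1 ^ 2) * (1 + varX * varY 1)⁻¹

/-- The substitution `x ↦ x exp (-x (y₁ + s))`, `z ↦ -s x y₁ - x y₂ + z`,
`y_k ↦ ∑_{j ≤ k} (k choose j) y_j s ^ (k - j)` for `k ≥ 1`. -/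
noncomputable def kernelSubst : Var → MvPowerSeries Var ℚ
  | Var.x => varX * expS (-varX * (varY 1 + serS))
  | Var.z => -serS * varX * varY 1 - varX * varY 2 + varZ
  | Var.y k => ∑ j ∈ Finset.range ((k : ℕ) + 1),
      (((k : ℕ).choose j : ℕ) : ℚ) • (varY j * serS ^ ((k : ℕ) - j))

/-- The substitution `x ↦ A(x, y)`, `y ↦ B(x, y)`. -/
noncomputable def simpleSubst : Fin 2 → MvPowerSeries (Fin 2) ℚ :=
  ![serA (MvPowerSeries.X 0) (MvPowerSeries.X 1), serB (MvPowerSeries.X 0) (MvPowerSeries.X 1)]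

end KernelEGF

namespace KernelEGF

/-! ### Summation over finite families of natural numbers -/

section Nonarchimedean

variable {R : Type} [CommRing R] [UniformSpace R] [IsUniformAddGroup R] [NonarchimedeanRing R]

/-! The weight of a multigraph is a product over unordered pairs of vertices, so the total weight of
all multigraphs on `n` vertices is `L ^ n * Y ^ n.choose 2`, where `L = exp (z / 2)` sums the loop
weights and `Y = ∑ y_k / k!` the weights of the multiplicities of a pair. By the exponential formula
`expS_egf_connSum`, the exponential of the connected series is the generating function of these
totals, `∑ (x L) ^ n Y ^ (n choose 2) / n!`.

For minimum degree three, `allSum_three_le` applies inclusion-exclusion over the sets `T` of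
vertices forced to have degree at most two. Fix the `n` vertices outside `T`. The part induced on
`T` consists of paths and cycles, signed by `(-1) ^ |T|`. Components not attached to the outside
contribute `closedExponent`: single vertices, longer paths, loops, double edges and longer cycles;
`serE` is what remains without the loop and double-edge terms. Pendant paths, and paths with both
ends attached to the same outer vertex, contribute `vertexExponent` for each outer vertex. Paths
joining two outer vertices contribute `s`, that is `chainSeries`, for each pair. Hence the signed
sum over `T` is `L ^ n * Y ^ n.choose 2` times the exponential of closed part `+ n ·` vertex part `+
(n choose 2) ·` chain part. This is `egf_typeSum`. It is not proved by decomposing graphs: deleting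
one bounded vertex at a time gives recurrences, these become a linear differential equation in `x`,
and `pderiv_exponent` checks that the exponential solves it.

Summing over `n` gives `hasSum_allSum_three_le`: after division by the closed factor the sum has the
same shape as for connected multigraphs, with `x L` multiplied by the exponential of the vertex part
and `Y` by `exp s`. The kernel substitution produces exactly these factors; for `Y` this is the
binomial convolution `hasSum_shiftedY`. Injectivity of `expS` then gives the first identity. The
second follows from the same comparison after setting `z` and all `y_k` with `k ≥ 2` to zero. -/

theorem hasSum_prod_fin (n : ℕ) (f : Fin n → ℕ → R) (a : Fin n → R)
    (h : ∀ i, HasSum (f i) (a i)) :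
    HasSum (fun g : Fin n → ℕ => ∏ i, f i (g i)) (∏ i, a i) := by
  induction n with
  | zero => simp
  | succ n ih =>
    have h1 := (h 0).mul_of_nonarchimedean (ih (fun i => f i.succ) _ fun i => h _)
    rw [← (Fin.consEquiv fun _ => ℕ).hasSum_iff, Fin.prod_univ_succ]
    refine h1.congr_fun fun g => ?_
    simp [Fin.prod_univ_succ, Fin.consEquiv]

theorem hasSum_prod_pi {ι : Type} [Fintype ι] (f : ι → ℕ → R) (a : ι → R)
    (h : ∀ i, HasSum (f i) (a i)) :
    HasSum (fun g : ι → ℕ => ∏ i, f i (g i)) (∏ i, a i) := by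
  let e := (Fintype.equivFin ι).symm
  have h1 := hasSum_prod_fin _ (fun i => f (e i)) (fun i => a (e i)) fun i => h _
  rw [← e.prod_comp a, ← (e.arrowCongr (Equiv.refl ℕ)).hasSum_iff]
  refine h1.congr_fun fun g => ?_
  simp [← e.prod_comp]

end Nonarchimedean

namespace Multigraph

/-! ### The pairs of vertices of a disjoint union -/

section Split

variable {U V : Type}

/-- The unordered pairs of a disjoint union. -/
noncomputable def sym2Sum (U V : Type) : Sym2 U ⊕ Sym2 V ⊕ U × V ≃ Sym2 (U ⊕ V) :=
  Equiv.ofBijective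
    (Sum.elim (Sym2.map Sum.inl)
      (Sum.elim (Sym2.map Sum.inr) fun p => s(Sum.inl p.1, Sum.inr p.2))) <| by
    constructor
    · rintro (a | b | ⟨u, v⟩) (a' | b' | ⟨u', v'⟩) h
      · exact congrArg _ (Sym2.map.injective Sum.inl_injective h)
      · induction a; induction b'; simp at h
      · induction a; simp at h
      · induction a'; induction b; simp at h
      · exact congrArg _ (congrArg _ (Sym2.map.injective Sum.inr_injective h))
      · induction b; simp at h
      · induction a'; simp at h
      · induction b'; simp at h
      · simpa using h
    · intro e
      induction e with | _ a b
      rcases a with a | a <;> rcases b with b | b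
      · exact ⟨Sum.inl s(a, b), rfl⟩
      · exact ⟨Sum.inr (Sum.inr (a, b)), rfl⟩
      · exact ⟨Sum.inr (Sum.inr (b, a)), Sym2.eq_swap⟩
      · exact ⟨Sum.inr (Sum.inl s(a, b)), rfl⟩

theorem prod_sym2_sum {M : Type} [CommMonoid M] [Fintype U] [Fintype V] [DecidableEq U]
    [DecidableEq V] (f : Sym2 (U ⊕ V) → M) :
    ∏ e, f e = (∏ e, f (Sym2.map Sum.inl e)) *
      ((∏ e, f (Sym2.map Sum.inr e)) * ∏ p : U × V, f s(Sum.inl p.1, Sum.inr p.2)) := by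
  rw [← (sym2Sum U V).prod_comp, Fintype.prod_sum_type, Fintype.prod_sum_type]
  rfl

theorem sum_sym2_sum {M : Type} [AddCommMonoid M] [Fintype U] [Fintype V] [DecidableEq U]
    [DecidableEq V] (f : Sym2 (U ⊕ V) → M) :
    ∑ e, f e = (∑ e, f (Sym2.map Sum.inl e)) +
      ((∑ e, f (Sym2.map Sum.inr e)) + ∑ p : U × V, f s(Sum.inl p.1, Sum.inr p.2)) := by
  rw [← (sym2Sum U V).sum_comp, Fintype.sum_sum_type, Fintype.sum_sum_type]
  rfl

/-- The multigraph induced along a map of vertices. -/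
def pull (f : U → V) (G : Multigraph V) : Multigraph U := fun e => G (e.map f)

/-- The multiplicities between the two parts of a disjoint union. -/
def cross (G : Multigraph (U ⊕ V)) : U × V → ℕ := fun p => G s(Sum.inl p.1, Sum.inr p.2)

/-- A multigraph on a disjoint union: the two parts and the edges between them. -/
noncomputable def splitEquiv (U V : Type) :
    Multigraph (U ⊕ V) ≃ Multigraph U × Multigraph V × (U × V → ℕ) :=
  Equiv.ofBijective (fun G => (pull Sum.inl G, pull Sum.inr G, cross G)) <| by
    constructor
    · intro G G' h
      simp only [Prod.mk.injEq] at h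
      obtain ⟨h1, h2, h3⟩ := h
      funext e
      obtain ⟨e | e | p, rfl⟩ := (sym2Sum U V).surjective e
      · exact congrFun h1 e
      · exact congrFun h2 e
      · exact congrFun h3 p
    · rintro ⟨G1, G2, h⟩
      refine ⟨fun e => Sum.elim G1 (Sum.elim G2 h) ((sym2Sum U V).symm e), ?_⟩
      refine Prod.ext ?_ (Prod.ext ?_ ?_)
      · funext e
        exact congrArg _ ((sym2Sum U V).symm_apply_apply (Sum.inl e))
      · funext e
        exact congrArg _ ((sym2Sum U V).symm_apply_apply (Sum.inr (Sum.inl e)))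
      · funext p
        exact congrArg _ ((sym2Sum U V).symm_apply_apply (Sum.inr (Sum.inr p)))

theorem splitEquiv_apply (G : Multigraph (U ⊕ V)) :
    splitEquiv U V G = (pull Sum.inl G, pull Sum.inr G, cross G) := rfl

theorem degree_inl [Fintype U] [Fintype V] (G : Multigraph (U ⊕ V)) (u : U) :
    G.degree (Sum.inl u) = (pull Sum.inl G).degree u + ∑ v, cross G (u, v) := by
  simp only [degree, Fintype.sum_sum_type, pull, cross, Sym2.map_mk]
  omega

theorem degree_inr [Fintype U] [Fintype V] (G : Multigraph (U ⊕ V)) (v : V) :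
    G.degree (Sum.inr v) = (pull Sum.inr G).degree v + ∑ u, cross G (u, v) := by
  simp only [degree, Fintype.sum_sum_type, pull, cross, Sym2.map_mk]
  simp only [Sym2.eq_swap (a := Sum.inr v)]
  omega

/-- Relabelling the unordered pairs of vertices. -/
def sym2Equiv (f : U ≃ V) : Sym2 U ≃ Sym2 V where
  toFun := Sym2.map f
  invFun := Sym2.map f.symm
  left_inv e := by simp [Sym2.map_map]
  right_inv e := by simp [Sym2.map_map]

/-- Relabelling the vertices. -/
def pullEquiv (e : U ≃ V) : Multigraph V ≃ Multigraph U where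
  toFun := pull e
  invFun := pull e.symm
  left_inv G := by funext x; simp [pull, Sym2.map_map]
  right_inv G := by funext x; simp [pull, Sym2.map_map]

theorem degree_pull [Fintype U] [Fintype V] (e : U ≃ V) (G : Multigraph V) (u : U) :
    (pull e G).degree u = G.degree (e u) := by
  simp [degree, pull, ← e.sum_comp]

theorem connected_pull (e : U ≃ V) (G : Multigraph V) :
    (pull e G).toSimple.Connected ↔ G.toSimple.Connected := by
  refine SimpleGraph.Iso.connected_iff ⟨e, ?_⟩
  intro a b
  simp [toSimple, pull]

end Split

/-! ### Weighted sums of multigraphs -/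

section Weights

variable {R : Type} [CommRing R] (lam mu : ℕ → R)

/-- The weight of `k` edges that join the given pair of vertices: `lam k` if these are loops,
`mu k` otherwise. -/
def edgeWeight {V : Type} [DecidableEq V] (e : Sym2 V) (k : ℕ) : R :=
  if e.IsDiag then lam k else mu k

/-- The weight of a multigraph. -/
def omega {V : Type} [Fintype V] [DecidableEq V] (G : Multigraph V) : R :=
  ∏ e, edgeWeight lam mu e (G e)

theorem omega_pull {U V : Type} [Fintype U] [DecidableEq U] [Fintype V] [DecidableEq V]
    (f : U ≃ V) (G : Multigraph V) : omega lam mu (pull f G) = omega lam mu G := by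
  rw [omega, omega, ← (sym2Equiv f).prod_comp]
  refine Finset.prod_congr rfl fun e _ => ?_
  induction e with | _ a b
  simp [edgeWeight, pull, sym2Equiv]

theorem omega_sum {U V : Type} [Fintype U] [DecidableEq U] [Fintype V] [DecidableEq V]
    (G : Multigraph (U ⊕ V)) :
    omega lam mu G = omega lam mu (pull Sum.inl G) *
      (omega lam mu (pull Sum.inr G) * ∏ p, mu (cross G p)) := by
  rw [omega, prod_sym2_sum]
  congr 1
  · refine Finset.prod_congr rfl fun e _ => ?_
    induction e with | _ a b
    simp [edgeWeight, pull]
  · congr 1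
    · refine Finset.prod_congr rfl fun e _ => ?_
      induction e with | _ a b
      simp [edgeWeight, pull]

variable [UniformSpace R]

open scoped Classical in
/-- The sum of the weights of the multigraphs with a given property. -/
noncomputable def wsum {V : Type} [Fintype V] [DecidableEq V] (p : Multigraph V → Prop) : R :=
  ∑' G, if p G then omega lam mu G else 0

theorem wsum_pull {U V : Type} [Fintype U] [DecidableEq U] [Fintype V] [DecidableEq V]
    (f : U ≃ V) {p : Multigraph U → Prop} {q : Multigraph V → Prop}
    (h : ∀ G, p (pull f G) ↔ q G) : wsum lam mu p = wsum lam mu q := by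
  classical
  rw [wsum, ← (pullEquiv f).tsum_eq]
  refine tsum_congr fun G => ?_
  simp only [pullEquiv, Equiv.coe_fn_mk, omega_pull, h]

variable {lam mu} [IsUniformAddGroup R] [NonarchimedeanRing R] {L Y : R}

/-- Multiplicities of different pairs are chosen independently, so the sum factors: one `L` for each
diagonal pair, one `Y` for each pair of distinct vertices. -/
theorem hasSum_omega (hl : HasSum lam L) (hm : HasSum mu Y) {V : Type} [Fintype V]
    [DecidableEq V] :
    HasSum (fun G : Multigraph V => omega lam mu G)
      (L ^ Fintype.card V * Y ^ (Fintype.card V).choose 2) := by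
  have := hasSum_prod_pi (fun e : Sym2 V => edgeWeight lam mu e)
    (fun e => if e.IsDiag then L else Y) fun e => by
      by_cases he : e.IsDiag
      · simp only [he, if_true]
        exact hl.congr_fun fun k => by simp [edgeWeight, he]
      · simp only [he, if_false]
        exact hm.congr_fun fun k => by simp [edgeWeight, he]
  convert! this
  rw [Finset.prod_ite, Finset.prod_const, Finset.prod_const, ← Fintype.card_subtype,
    ← Fintype.card_subtype, Sym2.card_subtype_diag, Sym2.card_subtype_not_diag]

open scoped Classical in
theorem summable_omega_ite [CompleteSpace R] (hl : Summable lam) (hm : Summable mu)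
    {V : Type} [Fintype V] [DecidableEq V] (p : Multigraph V → Prop) :
    Summable fun G : Multigraph V => if p G then omega lam mu G else 0 :=
  (hasSum_omega hl.hasSum hm.hasSum).summable.indicator {G | p G}

theorem wsum_true [T2Space R] (hl : HasSum lam L) (hm : HasSum mu Y) {V : Type} [Fintype V]
    [DecidableEq V] {p : Multigraph V → Prop} (hp : ∀ G, p G) :
    wsum lam mu p = L ^ Fintype.card V * Y ^ (Fintype.card V).choose 2 := by
  simp only [wsum, hp, if_true]
  exact (hasSum_omega hl hm).tsum_eq

end Weights

/-! ### The exponential formula -/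

section Reachable

variable {U V : Type}

theorem reachable_inl_iff {G : Multigraph (U ⊕ V)} (h0 : cross G = 0) {u : U} {x : U ⊕ V} :
    G.toSimple.Reachable (Sum.inl u) x ↔
      ∃ u', x = Sum.inl u' ∧ (pull Sum.inl G).toSimple.Reachable u u' := by
  constructor
  · intro h
    rw [SimpleGraph.reachable_iff_reflTransGen] at h
    induction h with
    | refl => exact ⟨u, rfl, SimpleGraph.Reachable.refl u⟩
    | tail _ hadj ih =>
      obtain ⟨u', rfl, hu'⟩ := ih
      rename_i c _
      rcases c with c | c
      · refine ⟨c, rfl, hu'.trans (SimpleGraph.Adj.reachable ⟨fun h => hadj.1 (h ▸ rfl), hadj.2⟩)⟩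
      · exact absurd (congrFun h0 (u', c)) hadj.2
  · rintro ⟨u', rfl, h⟩
    rw [SimpleGraph.reachable_iff_reflTransGen] at h
    induction h with
    | refl => exact SimpleGraph.Reachable.refl _
    | tail _ hadj ih =>
      exact ih.trans (SimpleGraph.Adj.reachable
        ⟨fun h => hadj.1 (Sum.inl_injective h), hadj.2⟩)

/-- Used to recognise the component of a chosen vertex: it is the left part exactly when that part
is connected and no edge leaves it. -/
theorem component_eq_inl_iff {G : Multigraph (U ⊕ V)} {u : U} :
    (∀ x, G.toSimple.Reachable (Sum.inl u) x ↔ x.isLeft = true) ↔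
      (pull Sum.inl G).toSimple.Connected ∧ cross G = 0 := by
  constructor
  · intro h
    have h0 : cross G = 0 := by
      funext ⟨a, b⟩
      by_contra hne
      have h1 : G.toSimple.Reachable (Sum.inl a) (Sum.inr b) :=
        SimpleGraph.Adj.reachable ⟨Sum.inl_ne_inr, hne⟩
      simpa using (h (Sum.inr b)).1 (((h (Sum.inl a)).2 rfl).trans h1)
    refine ⟨?_, h0⟩
    have h2 : ∀ a, (pull Sum.inl G).toSimple.Reachable u a := fun a => by
      obtain ⟨u', h1, h2⟩ := (reachable_inl_iff h0).1 ((h (Sum.inl a)).2 rfl)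
      rwa [Sum.inl_injective h1]
    exact (SimpleGraph.connected_iff _).2 ⟨fun a b => (h2 a).symm.trans (h2 b), ⟨u⟩⟩
  · rintro ⟨hc, h0⟩ x
    rw [reachable_inl_iff h0]
    rcases x with x | x
    · simpa using hc.preconnected u x
    · simp

theorem reachable_pull (e : U ≃ V) (G : Multigraph V) (a b : U) :
    (pull e G).toSimple.Reachable a b ↔ G.toSimple.Reachable (e a) (e b) := by
  let f : (pull e G).toSimple ≃g G.toSimple := ⟨e, by intro a b; simp [toSimple, pull]⟩
  exact (f.reachable_iff (u := a) (v := b)).symm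

end Reachable

section Sums

variable {R : Type} [CommRing R] {lam mu : ℕ → R} [UniformSpace R]

/-- The total weight of the multigraphs all of whose degrees satisfy `D`. -/
noncomputable def allSum (lam mu : ℕ → R) (D : ℕ → Prop) (V : Type) [Fintype V]
    [DecidableEq V] : R :=
  wsum lam mu fun G : Multigraph V => ∀ v, D (G.degree v)

/-- The total weight of the connected multigraphs all of whose degrees satisfy `D`. -/
noncomputable def connSum (lam mu : ℕ → R) (D : ℕ → Prop) (V : Type) [Fintype V]
    [DecidableEq V] : R :=
  wsum lam mu fun G : Multigraph V => G.toSimple.Connected ∧ ∀ v, D (G.degree v)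

theorem allSum_equiv (D : ℕ → Prop) {U V : Type} [Fintype U] [DecidableEq U] [Fintype V]
    [DecidableEq V] (e : U ≃ V) : allSum lam mu D U = allSum lam mu D V :=
  wsum_pull _ _ e fun G => by simp only [degree_pull, e.forall_congr_left, e.apply_symm_apply]

theorem connSum_equiv (D : ℕ → Prop) {U V : Type} [Fintype U] [DecidableEq U] [Fintype V]
    [DecidableEq V] (e : U ≃ V) : connSum lam mu D U = connSum lam mu D V :=
  wsum_pull _ _ e fun G => by
    simp only [degree_pull, e.forall_congr_left, e.apply_symm_apply, connected_pull]

variable [IsUniformAddGroup R] [NonarchimedeanRing R] [CompleteSpace R] [T2Space R]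

/-- With no edges across, every crossing pair contributes `mu 0 = 1`, and the weight splits as a
product. -/
theorem wsum_disjoint (hl : Summable lam) (hm : Summable mu) (hm0 : mu 0 = 1) {U V : Type}
    [Fintype U] [DecidableEq U] [Fintype V] [DecidableEq V] (p : Multigraph U → Prop)
    (q : Multigraph V → Prop) :
    wsum lam mu (fun G : Multigraph (U ⊕ V) =>
      p (pull Sum.inl G) ∧ q (pull Sum.inr G) ∧ cross G = 0) = wsum lam mu p * wsum lam mu q := by
  classical
  have hinj : Function.Injective (fun g : Multigraph U × Multigraph V =>
      (g.1, g.2, (0 : U × V → ℕ))) := fun a b h => by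
    simp only [Prod.mk.injEq] at h
    exact Prod.ext h.1 h.2.1
  rw [wsum, wsum, wsum, tsum_mul_tsum_of_nonarchimedean (summable_omega_ite hl hm p)
    (summable_omega_ite hl hm q)]
  let F : Multigraph U × Multigraph V × (U × V → ℕ) → R := fun g =>
    if p g.1 ∧ q g.2.1 ∧ g.2.2 = 0 then
      omega lam mu g.1 * (omega lam mu g.2.1 * ∏ e, mu (g.2.2 e)) else 0
  calc _ = ∑' G : Multigraph (U ⊕ V), F (splitEquiv U V G) := by
        refine tsum_congr fun G => ?_
        simp only [F, splitEquiv_apply, ← omega_sum]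
        congr
    _ = ∑' g, F g := (splitEquiv U V).tsum_eq F
    _ = ∑' g : Multigraph U × Multigraph V, F (g.1, g.2, 0) := by
        refine (hinj.tsum_eq fun g hg => ?_).symm
        by_contra hne
        refine hg (if_neg fun h => hne ⟨(g.1, g.2.1), ?_⟩)
        exact Prod.ext rfl (Prod.ext rfl h.2.2.symm)
    _ = _ := by
        refine tsum_congr fun g => ?_
        simp only [F, Pi.zero_apply, hm0, Finset.prod_const_one, mul_one, ite_and]
        by_cases h1 : p g.1 <;> by_cases h2 : q g.2 <;> simp [h1, h2]

theorem wsum_component_eq (hl : Summable lam) (hm : Summable mu) (hm0 : mu 0 = 1)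
    (D : ℕ → Prop) {V : Type} [Fintype V] [DecidableEq V] (v₀ : V) (S : Finset V) (hS : v₀ ∈ S) :
    wsum lam mu (fun G : Multigraph V => (∀ v, D (G.degree v)) ∧
        ∀ v, G.toSimple.Reachable v₀ v ↔ v ∈ S) =
      connSum lam mu D {v // v ∈ S} * allSum lam mu D {v // v ∉ S} := by
  rw [connSum, allSum, ← wsum_disjoint hl hm hm0]
  symm
  refine wsum_pull _ _ (Equiv.sumCompl fun v => v ∈ S) fun G => ?_
  set e := Equiv.sumCompl fun v => v ∈ S
  set G' := pull e G
  have h1 : (∀ v, G.toSimple.Reachable v₀ v ↔ v ∈ S) ↔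
      (pull Sum.inl G').toSimple.Connected ∧ cross G' = 0 := by
    rw [← component_eq_inl_iff (u := ⟨v₀, hS⟩), ← e.forall_congr_right]
    refine forall_congr' fun x => ?_
    rw [reachable_pull]
    refine iff_congr Iff.rfl ?_
    rcases x with x | x
    · simp [e]
    · simpa [e] using x.2
  have h2 : (∀ v, D (G.degree v)) ↔ ∀ v, D (G'.degree v) := by
    simp only [G', degree_pull, e.forall_congr_left, e.apply_symm_apply]
  rw [h1, h2]
  constructor
  · rintro ⟨⟨hc, hd⟩, hd', h0⟩
    refine ⟨?_, hc, h0⟩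
    rintro (v | v)
    · simpa [degree_inl, h0] using hd v
    · simpa [degree_inr, h0] using hd' v
  · rintro ⟨hd, hc, h0⟩
    refine ⟨⟨hc, fun v => ?_⟩, fun v => ?_, h0⟩
    · simpa [degree_inl, h0] using hd (Sum.inl v)
    · simpa [degree_inr, h0] using hd (Sum.inr v)

/-- Each multigraph is counted once, at the set `S` of vertices reachable from `v₀`. -/
theorem allSum_eq_sum_component (hl : Summable lam) (hm : Summable mu) (hm0 : mu 0 = 1)
    (D : ℕ → Prop) {V : Type} [Fintype V] [DecidableEq V] (v₀ : V) :
    allSum lam mu D V = ∑ S : Finset V with v₀ ∈ S,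
      connSum lam mu D {v // v ∈ S} * allSum lam mu D {v // v ∉ S} := by
  classical
  rw [Finset.sum_congr rfl fun S hS =>
    (wsum_component_eq hl hm hm0 D v₀ S (Finset.mem_filter.1 hS).2).symm]
  unfold allSum wsum
  rw [← Summable.tsum_finsetSum fun S _ => summable_omega_ite hl hm _]
  refine tsum_congr fun G => ?_
  rw [Finset.sum_eq_single (Finset.univ.filter fun v => G.toSimple.Reachable v₀ v)]
  · simp
  · intro S _ hne
    refine if_neg fun h => hne ?_
    ext v
    simp [h.2 v]
  · intro h
    simp at h

/-- The coefficient form of `(exp C)' = C' exp C`: the component of a distinguished vertex takes `j`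
of the other `n` vertices. -/
theorem allSum_succ (hl : Summable lam) (hm : Summable mu) (hm0 : mu 0 = 1)
    (D : ℕ → Prop) (n : ℕ) :
    allSum lam mu D (Fin (n + 1)) = ∑ j ∈ Finset.range (n + 1),
      n.choose j • (connSum lam mu D (Fin (j + 1)) * allSum lam mu D (Fin (n - j))) := by
  rw [allSum_equiv D (finSuccEquiv n), allSum_eq_sum_component hl hm hm0 D none]
  have h1 : ∀ S : Finset (Option (Fin n)),
      connSum lam mu D {v // v ∈ S} * allSum lam mu D {v // v ∉ S} =
        connSum lam mu D (Fin S.card) * allSum lam mu D (Fin (n + 1 - S.card)) := fun S => by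
    rw [connSum_equiv D (Fintype.equivFinOfCardEq (n := S.card) (by simp)),
      allSum_equiv D (Fintype.equivFinOfCardEq (n := n + 1 - S.card) (by
        rw [Fintype.card_subtype_compl]; simp))]
  simp only [h1]
  have h2 := Finset.sum_powerset_apply_card (f := fun j =>
    connSum lam mu D (Fin (j + 1)) * allSum lam mu D (Fin (n - j)))
    (x := (Finset.univ : Finset (Fin n)))
  rw [Finset.card_univ, Fintype.card_fin] at h2
  rw [← h2]
  symm
  -- Sets containing `none` correspond to arbitrary subsets of `Fin n`; the cardinality drops by
  -- one.
  refine Finset.sum_nbij' (fun S => Finset.insertNone S) (fun S => Finset.eraseNone S)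
    ?_ ?_ ?_ ?_ ?_
  · simp
  · simp
  · simp
  · intro S hS
    simp only [Finset.mem_filter, Finset.mem_univ, true_and] at hS
    simp [Finset.insert_eq_of_mem hS]
  · intro S _
    rw [Finset.card_insertNone, Nat.add_sub_add_right]

end Sums

/-! ### Multigraphs with bounded degrees -/

section PairCount

variable {V : Type} [DecidableEq V]

/-- The multiplicities of the vertices in an unordered pair. -/
def pairCount (e : Sym2 V) : V → ℕ :=
  Sym2.lift ⟨fun a b => Pi.single a 1 + Pi.single b 1, fun _ _ => add_comm _ _⟩ e

theorem pairCount_mk (a b : V) : pairCount s(a, b) = Pi.single a 1 + Pi.single b 1 := rfl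

theorem pairCount_injective : Function.Injective (pairCount : Sym2 V → V → ℕ) := by
  intro e e' h
  induction e with | _ a b
  induction e' with | _ c d
  rw [pairCount_mk, pairCount_mk] at h
  have ha := congrFun h a
  have hb := congrFun h b
  have hc := congrFun h c
  simp only [Pi.add_apply, Pi.single_apply] at ha hb hc
  rw [Sym2.eq_iff]
  grind

variable [Fintype V]

theorem sum_pairCount (e : Sym2 V) : ∑ v, pairCount e v = 2 := by
  induction e with | _ a b
  simp [pairCount_mk, Finset.sum_add_distrib]

theorem exists_eq_add_single {h : V → ℕ} {k : ℕ} (hk : ∑ v, h v = k + 1) :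
    ∃ (w : V) (h' : V → ℕ), h = h' + Pi.single w 1 ∧ ∑ v, h' v = k := by
  obtain ⟨w, -, hw⟩ := Finset.exists_ne_zero_of_sum_ne_zero (by omega : ∑ v, h v ≠ 0)
  have h1 : h = Function.update h w (h w - 1) + Pi.single w 1 := by
    funext v
    by_cases hv : v = w
    · subst hv
      simp
      omega
    · simp [hv]
  refine ⟨w, _, h1, ?_⟩
  rw [h1] at hk
  simpa [Finset.sum_add_distrib] using hk

theorem exists_eq_single {h : V → ℕ} (hk : ∑ v, h v = 1) : ∃ w, h = Pi.single w 1 := by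
  obtain ⟨w, h', rfl, h0⟩ := exists_eq_add_single hk
  refine ⟨w, ?_⟩
  have : h' = 0 := by
    funext v
    simpa using Finset.sum_eq_zero_iff.1 h0 v
  simp [this]

theorem exists_eq_pairCount {h : V → ℕ} (hk : ∑ v, h v = 2) : ∃ e, h = pairCount e := by
  obtain ⟨w, h', rfl, h1⟩ := exists_eq_add_single hk
  obtain ⟨a, rfl⟩ := exists_eq_single h1
  exact ⟨s(a, w), rfl⟩

theorem prod_single {M : Type} [CommMonoid M] {f : ℕ → M} (hf : f 0 = 1) (w : V) (k : ℕ) :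
    ∏ v, f ((Pi.single w k : V → ℕ) v) = f k := by
  rw [Fintype.prod_eq_single w fun v hv => by simp [hv, hf]]
  simp

theorem prod_pairCount {M : Type} [CommMonoid M] {f : ℕ → M} (hf : f 0 = 1) (e : Sym2 V) :
    ∏ v, f (pairCount e v) = if e.IsDiag then f 2 else f 1 ^ 2 := by
  induction e with | _ a b
  by_cases hab : a = b
  · subst hab
    have : pairCount s(a, a) = Pi.single a 2 := by
      rw [pairCount_mk, ← Pi.single_add]
    rw [this, prod_single hf]
    simp
  · rw [Fintype.prod_eq_mul a b hab fun v hv => by simp [pairCount_mk, hv.1, hv.2, hf]]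
    simp [pairCount_mk, hab, Ne.symm hab, pow_two]

end PairCount

/-! ### Deleting a vertex of bounded degree -/

section Bounded

variable {R : Type} [CommRing R] (lam mu : ℕ → R) [UniformSpace R]

/-- The total weight of the multigraphs such that the degree of every vertex `v` is at most
`β v`. -/
noncomputable def boundSum {V : Type} [Fintype V] [DecidableEq V] (β : V → ℕ∞) : R :=
  wsum lam mu fun G => ∀ v, (G.degree v : ℕ∞) ≤ β v

variable {lam mu}

/-- Equal multisets of bounds give fibres of equal size, hence a relabelling of the vertices that
carries one bound to the other. -/
theorem boundSum_congr {U V : Type} [Fintype U] [DecidableEq U] [Fintype V] [DecidableEq V]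
    {β : U → ℕ∞} {γ : V → ℕ∞}
    (h : Finset.univ.val.map β = Finset.univ.val.map γ) :
    boundSum lam mu β = boundSum lam mu γ := by
  have hc : ∀ b, Fintype.card {u // β u = b} = Fintype.card {v // γ v = b} := fun b => by
    have := congrArg (Multiset.count b) h
    rw [Multiset.count_map, Multiset.count_map] at this
    rw [Fintype.card_subtype, Fintype.card_subtype, Finset.card, Finset.card, Finset.filter_val,
      Finset.filter_val]
    simpa only [eq_comm] using this
  let e : U ≃ V := (Equiv.sigmaFiberEquiv β).symm.trans
    ((Equiv.sigmaCongrRight fun b => Fintype.equivOfCardEq (hc b)).trans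
      (Equiv.sigmaFiberEquiv γ))
  have he : ∀ u, γ (e u) = β u := fun u =>
    (Fintype.equivOfCardEq (hc (β u)) ⟨u, rfl⟩).2
  refine wsum_pull _ _ e fun G => ?_
  rw [← e.forall_congr_right]
  simp only [degree_pull, he]

variable [IsUniformAddGroup R] [NonarchimedeanRing R] [CompleteSpace R] [T2Space R]

/-- A multigraph on the vertices `()` and `V`: the number of loops at `()`, the edges from `()`
to `V`, and the multigraph on `V`. -/
noncomputable def elimEquiv (V : Type) :
    Multigraph (Unit ⊕ V) ≃ (ℕ × (V → ℕ)) × Multigraph V :=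
  (splitEquiv Unit V).trans <|
    ((Equiv.funUnique (Sym2 Unit) ℕ).prodCongr
      ((Equiv.prodComm _ _).trans
        (((Equiv.uniqueProd V Unit).arrowCongr (Equiv.refl ℕ)).prodCongr (Equiv.refl _)))).trans
    (Equiv.prodAssoc _ _ _).symm

theorem elimEquiv_apply {V : Type} (G : Multigraph (Unit ⊕ V)) :
    elimEquiv V G = ((pull Sum.inl G s((), ()), fun v => cross G ((), v)), pull Sum.inr G) := rfl

open scoped Classical in
-- Delete the distinguished vertex, recording its loops `p.1` and its edges `p.2` to the rest; those
-- edges use up part of the other bounds. The requirement `p.2 v ≤ β v` stays explicit because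
-- truncated subtraction would hide a violation.
theorem boundSum_elim (hl : Summable lam) (hm : Summable mu) {V : Type} [Fintype V]
    [DecidableEq V] (b : ℕ∞) (β : V → ℕ∞) :
    boundSum lam mu (Sum.elim (fun _ : Unit => b) β) = ∑' p : ℕ × (V → ℕ),
      if ((2 * p.1 + ∑ v, p.2 v : ℕ) : ℕ∞) ≤ b ∧ ∀ v, (p.2 v : ℕ∞) ≤ β v then
        lam p.1 * (∏ v, mu (p.2 v)) * boundSum lam mu (fun v => β v - p.2 v) else 0 := by
  obtain ⟨r, hr⟩ : ∃ r : (V → ℕ) → Multigraph V → Prop, r = fun h G =>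
    ∀ v, (G.degree v : ℕ∞) ≤ β v - h v := ⟨_, rfl⟩
  let F : (ℕ × (V → ℕ)) × Multigraph V → R := fun q =>
    if ((2 * q.1.1 + ∑ v, q.1.2 v : ℕ) : ℕ∞) ≤ b ∧ ∀ v, (q.1.2 v : ℕ∞) ≤ β v then
      lam q.1.1 * (∏ v, mu (q.1.2 v)) *
        (if r q.1.2 q.2 then omega lam mu q.2 else 0) else 0
  obtain ⟨p, hp⟩ : ∃ p : Multigraph (Unit ⊕ V) → Prop, p = fun G =>
    ∀ v, (G.degree v : ℕ∞) ≤ Sum.elim (fun _ : Unit => b) β v := ⟨_, rfl⟩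
  have hF : ∀ G, (if p G then omega lam mu G else 0) = F (elimEquiv V G) := fun G => by
    have h1 : omega lam mu (pull Sum.inl G) = lam (pull Sum.inl G s((), ())) := by
      rw [omega, Fintype.prod_unique]
      simp [edgeWeight]
      rfl
    have h2 : ∏ p, mu (cross G p) = ∏ v, mu (cross G ((), v)) :=
      (Fintype.prod_equiv (Equiv.uniqueProd V Unit) _ _ fun _ => rfl)
    have h3 : p G ↔
        (((2 * pull Sum.inl G s((), ()) + ∑ v, cross G ((), v) : ℕ) : ℕ∞) ≤ b ∧
          ∀ v, (cross G ((), v) : ℕ∞) ≤ β v) ∧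
        r (fun v => cross G ((), v)) (pull Sum.inr G) := by
      simp only [hp, hr]
      rw [Sum.forall, and_assoc, ← forall_and]
      refine and_congr ?_ (forall_congr' fun v => ?_)
      · have h4 : G.degree (Sum.inl ()) =
            2 * pull Sum.inl G s((), ()) + ∑ v, cross G ((), v) := by
          rw [degree_inl]
          simp [degree, two_mul]
        exact ⟨fun h => h4 ▸ h (), fun h _ => (congrArg _ h4).trans_le h⟩
      · rw [degree_inr, Sum.elim_inr]
        simp only [Finset.univ_unique, Finset.sum_singleton, Nat.cast_add]
        change _ + ((cross G ((), v) : ℕ) : ℕ∞) ≤ _ ↔ _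
        constructor
        · intro h
          exact ⟨le_trans le_add_self h, ENat.le_sub_of_add_le_right (ENat.natCast_ne_top _) h⟩
        · rintro ⟨h, h'⟩
          exact (add_le_add_left h' _).trans_eq (tsub_add_cancel_of_le h)
    simp only [h3, F, elimEquiv_apply, omega_sum, h1, h2]
    by_cases c1 : ((2 * pull Sum.inl G s((), ()) + ∑ v, cross G ((), v) : ℕ) : ℕ∞) ≤ b ∧
          ∀ v, (cross G ((), v) : ℕ∞) ≤ β v
    · by_cases c2 : r (fun v => cross G ((), v)) (pull Sum.inr G)
      · rw [if_pos ⟨c1, c2⟩, if_pos c1, if_pos c2]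
        ring
      · rw [if_neg fun h => c2 h.2, if_pos c1, if_neg c2, mul_zero]
    · rw [if_neg fun h => c1 h.1, if_neg c1]
  have hs : Summable F := by
    rw [← (elimEquiv V).summable_iff]
    exact (summable_omega_ite hl hm p).congr hF
  rw [boundSum, ← hp, wsum]
  calc _ = ∑' G, F (elimEquiv V G) := tsum_congr fun G => hF G
    _ = ∑' q, F q := (elimEquiv V).tsum_eq F
    _ = ∑' p, ∑' G, F (p, G) := hs.tsum_prod
    _ = _ := by
      refine tsum_congr fun p => ?_
      simp only [F]
      split_ifs
      · rw [(summable_omega_ite hl hm _).tsum_mul_left, boundSum, wsum, hr]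
      · exact tsum_zero

theorem boundSum_elim_zero (hl : Summable lam) (hm : Summable mu) (hl0 : lam 0 = 1)
    (hm0 : mu 0 = 1) {V : Type} [Fintype V] [DecidableEq V] (β : V → ℕ∞) :
    boundSum lam mu (Sum.elim (fun _ : Unit => 0) β) = boundSum lam mu β := by
  classical
  rw [boundSum_elim hl hm, tsum_eq_single (0, 0)]
  · simp [hl0, hm0]
  · rintro ⟨l, h⟩ hne
    refine if_neg fun hh => hne ?_
    have h1 : 2 * l + ∑ v, h v = 0 := by simpa using hh.1
    have h2 : h = 0 := by
      funext v
      simpa using Finset.sum_eq_zero_iff.1 (by omega : ∑ v, h v = 0) v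
    rw [h2, show l = 0 by omega]

/-- A vertex of degree at most one is isolated or hangs from a single `w` by a simple edge; `hβ`
makes every `w` admissible. -/
theorem boundSum_elim_one (hl : Summable lam) (hm : Summable mu) (hl0 : lam 0 = 1)
    (hm0 : mu 0 = 1) {V : Type} [Fintype V] [DecidableEq V] (β : V → ℕ∞) (hβ : ∀ v, 1 ≤ β v) :
    boundSum lam mu (Sum.elim (fun _ : Unit => 1) β) = boundSum lam mu β +
      ∑ w, mu 1 * boundSum lam mu (fun v => β v - (Pi.single w 1 : V → ℕ) v) := by
  classical
  -- An injective list of all local configurations at the deleted vertex; the infinite sum is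
  -- supported on its range.
  let f : Unit ⊕ V → ℕ × (V → ℕ) := Sum.elim (fun _ => (0, 0)) fun w => (0, Pi.single w 1)
  have hf : Function.Injective f := by
    rintro (a | a) (b | b) h
    · rfl
    · have := congrArg (fun p => ∑ v, p.2 v) h
      simp [f] at this
    · have := congrArg (fun p => ∑ v, p.2 v) h
      simp [f] at this
    · have := congrFun (congrArg Prod.snd h) a
      simp only [f, Sum.elim_inr, Pi.single_apply, if_true] at this
      congr 1
      by_contra hab
      simp [hab] at this
  rw [boundSum_elim hl hm, ← hf.tsum_eq, tsum_fintype, Fintype.sum_sum_type]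
  · congr 1
    · simp [f, hl0, hm0]
    · refine Finset.sum_congr rfl fun w _ => ?_
      have h2 : ∀ v, (((Pi.single w 1 : V → ℕ) v : ℕ) : ℕ∞) ≤ β v := fun v => by
        refine le_trans ?_ (hβ v)
        by_cases h : v = w <;> simp [h]
      simp only [f, Sum.elim_inr, h2, hl0, prod_single hm0]
      simp
  · rintro ⟨l, h⟩ hne
    obtain ⟨hh, -⟩ := (ite_ne_right_iff.1 hne).1
    have h1 : 2 * l + ∑ v, h v ≤ 1 := by exact_mod_cast hh
    obtain rfl : l = 0 := by omega
    rcases (by omega : ∑ v, h v = 0 ∨ ∑ v, h v = 1) with h0 | h0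
    · refine ⟨Sum.inl (), Prod.ext rfl (funext fun v => ?_)⟩
      simpa [f, eq_comm] using Finset.sum_eq_zero_iff.1 h0 v
    · obtain ⟨w, rfl⟩ := exists_eq_single h0
      exact ⟨Sum.inr w, rfl⟩

/-- The deleted vertex is isolated, carries one loop, has one edge, or has two edges whose far ends
form an unordered pair. A diagonal pair is a double edge of weight `mu 2`, any other is two simple
edges. -/
theorem boundSum_elim_two (hl : Summable lam) (hm : Summable mu) (hl0 : lam 0 = 1)
    (hm0 : mu 0 = 1) {V : Type} [Fintype V] [DecidableEq V] (β : V → ℕ∞) (hβ : ∀ v, 2 ≤ β v) :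
    boundSum lam mu (Sum.elim (fun _ : Unit => 2) β) = (1 + lam 1) * boundSum lam mu β +
      ∑ w, mu 1 * boundSum lam mu (fun v => β v - (Pi.single w 1 : V → ℕ) v) +
      ∑ e : Sym2 V, (if e.IsDiag then mu 2 else mu 1 ^ 2) *
        boundSum lam mu (fun v => β v - pairCount e v) := by
  classical
  let f : Bool ⊕ V ⊕ Sym2 V → ℕ × (V → ℕ) := Sum.elim (fun b => (cond b 1 0, 0))
    (Sum.elim (fun w => (0, Pi.single w 1)) fun e => (0, pairCount e))
  have hf1 : ∀ i, ∑ v, (f i).2 v = Sum.elim (fun _ => 0) (Sum.elim (fun _ => 1) fun _ => 2) i := by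
    rintro (i | i | i)
    · simp [f]
    · simp [f]
    · simp [f, sum_pairCount]
  have hf2 : ∀ i, 2 * (f i).1 + ∑ v, (f i).2 v ≤ 2 := by
    rintro ((_ | _) | i | i) <;> rw [hf1] <;> simp [f]
  have hf3 : ∀ i, ∀ v, ((f i).2 v : ℕ∞) ≤ β v := fun i v => by
    refine le_trans ?_ (hβ v)
    have := Finset.single_le_sum (f := (f i).2) (fun _ _ => Nat.zero_le _) (Finset.mem_univ v)
    have := hf2 i
    exact_mod_cast (by omega : (f i).2 v ≤ 2)
  have hf : Function.Injective f := by
    intro i j h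
    have h1 := hf1 i
    rw [h, hf1 j] at h1
    rcases i with i | i | i <;> rcases j with j | j | j <;> try simp at h1
    · have := congrArg Prod.fst h
      cases i <;> cases j <;> simp [f] at this ⊢
    · have := congrFun (congrArg Prod.snd h) i
      simp only [f, Sum.elim_inr, Sum.elim_inl, Pi.single_apply, if_true] at this
      congr 2
      by_contra hab
      simp [hab] at this
    · congr 2
      exact pairCount_injective (congrArg Prod.snd h)
  rw [boundSum_elim hl hm, ← hf.tsum_eq, tsum_fintype]
  · have h4 : ∀ i, (((2 * (f i).1 + ∑ v, (f i).2 v : ℕ) : ℕ∞) ≤ 2 ∧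
        ∀ v, ((f i).2 v : ℕ∞) ≤ β v) := fun i => ⟨by exact_mod_cast hf2 i, hf3 i⟩
    simp only [h4, if_true, and_self, implies_true]
    rw [Fintype.sum_sum_type, Fintype.sum_sum_type, ← add_assoc]
    congr 1
    · congr 1
      · simp [f, hl0, hm0]
        ring
      · simp only [f, Sum.elim_inr, Sum.elim_inl, hl0, prod_single hm0, one_mul]
    · simp only [f, Sum.elim_inr, hl0, prod_pairCount hm0, one_mul]
  · rintro ⟨l, h⟩ hne
    obtain ⟨hh, -⟩ := (ite_ne_right_iff.1 hne).1
    have h1 : 2 * l + ∑ v, h v ≤ 2 := by exact_mod_cast hh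
    by_cases h0 : ∑ v, h v = 0
    · have h2 : h = 0 := by
        funext v
        simpa using Finset.sum_eq_zero_iff.1 h0 v
      rcases (by omega : l = 0 ∨ l = 1) with rfl | rfl
      · exact ⟨Sum.inl false, by simp [f, h2]⟩
      · exact ⟨Sum.inl true, by simp [f, h2]⟩
    · obtain rfl : l = 0 := by omega
      rcases (by omega : ∑ v, h v = 1 ∨ ∑ v, h v = 2) with h0 | h0
      · obtain ⟨w, rfl⟩ := exists_eq_single h0
        exact ⟨Sum.inr (Sum.inl w), rfl⟩
      · obtain ⟨e, rfl⟩ := exists_eq_pairCount h0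
        exact ⟨Sum.inr (Sum.inr e), rfl⟩

end Bounded

section MapUniv

variable {U V X : Type} [Fintype U] [Fintype V]

theorem map_univ_sum (f : U ⊕ V → X) : Finset.univ.val.map f =
    Finset.univ.val.map (fun u => f (Sum.inl u)) +
      Finset.univ.val.map fun v => f (Sum.inr v) := by
  rw [← Finset.univ_disjSum_univ, Finset.val_disjSum, Multiset.disjSum, Multiset.map_add,
    Multiset.map_map, Multiset.map_map]
  rfl

theorem map_univ_of_notMem [DecidableEq V] (f : V → X) (s : Finset V) (b : X)
    (h : ∀ v, v ∉ s → f v = b) : Finset.univ.val.map f =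
    s.val.map f + Multiset.replicate (Fintype.card V - s.card) b := by
  have h1 : (Finset.univ : Finset V).val = s.val + sᶜ.val := by
    rw [← Finset.disjUnion_val _ _ disjoint_compl_right, Finset.disjUnion_eq_union,
      Finset.union_compl]
  have h2 : sᶜ.val.map f = sᶜ.val.map fun _ => b :=
    Multiset.map_congr rfl fun v hv => h v (by simpa using hv)
  rw [h1, Multiset.map_add, h2, Multiset.map_const', Finset.card_val, Finset.card_compl]

end MapUniv

/-! ### Recurrences by numbers of bounded vertices, and inclusion-exclusion -/

section Counts

variable {R : Type} [CommRing R] (lam mu : ℕ → R) [UniformSpace R]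

/-- The degree bounds: none for `m` vertices, `2` for `t` vertices and `1` for `j` vertices. -/
def bounds (m t j : ℕ) : Fin m ⊕ Fin t ⊕ Fin j → ℕ∞ :=
  Sum.elim (fun _ => ⊤) (Sum.elim (fun _ => 2) fun _ => 1)

/-- The total weight of the multigraphs with `m + t + j` vertices such that `t` given vertices have
degree at most two and `j` further given vertices have degree at most one. -/
noncomputable def typeSum (m t j : ℕ) : R := boundSum lam mu (bounds m t j)

variable {lam mu}

theorem map_bounds (m t j : ℕ) : Finset.univ.val.map (bounds m t j) =
    Multiset.replicate m ⊤ + (Multiset.replicate t 2 + Multiset.replicate j 1) := by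
  simp [map_univ_sum, bounds, Multiset.map_const']

theorem boundSum_eq_typeSum {V : Type} [Fintype V] [DecidableEq V] {β : V → ℕ∞} {m t j : ℕ}
    (h : Finset.univ.val.map β =
      Multiset.replicate m ⊤ + (Multiset.replicate t 2 + Multiset.replicate j 1)) :
    boundSum lam mu β = typeSum lam mu m t j :=
  boundSum_congr (h.trans (map_bounds m t j).symm)

variable [IsUniformAddGroup R] [NonarchimedeanRing R] [T2Space R]

theorem typeSum_zero_zero {L Y : R} (hl : HasSum lam L) (hm : HasSum mu Y) (m : ℕ) :
    typeSum lam mu m 0 0 = L ^ m * Y ^ m.choose 2 := by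
  rw [typeSum, boundSum, wsum_true hl hm]
  · simp
  · rintro G (v | v | v)
    · simp [bounds]
    · exact v.elim0
    · exact v.elim0

variable [CompleteSpace R]

/-- Delete a vertex of bound one. Its possible neighbour is unbounded and unaffected, or drops from
bound two to one, or drops from one to zero and is then isolated. The truncated `t - 1` and `j - 1`
occur only with factors `t` and `j`. -/
theorem typeSum_succ_right (hl : Summable lam) (hm : Summable mu) (hl0 : lam 0 = 1)
    (hm0 : mu 0 = 1) (m t j : ℕ) :
    typeSum lam mu m t (j + 1) = typeSum lam mu m t j + mu 1 * (m * typeSum lam mu m t j +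
      t * typeSum lam mu m (t - 1) (j + 1) + j * typeSum lam mu m t (j - 1)) := by
  have h0 : typeSum lam mu m t (j + 1) =
      boundSum lam mu (Sum.elim (fun _ : Unit => 1) (bounds m t j)) := by
    symm
    refine boundSum_eq_typeSum ?_
    rw [map_univ_sum]
    simp [map_bounds, Multiset.replicate_succ]
  rw [h0, boundSum_elim_one hl hm hl0 hm0 _ (by rintro (v | v | v) <;> simp [bounds])]
  congr 1
  rw [← Finset.mul_sum, Fintype.sum_sum_type, Fintype.sum_sum_type, ← add_assoc]
  congr 3
  · rw [Finset.sum_congr rfl (g := fun _ => typeSum lam mu m t j) fun w _ => ?_]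
    · simp
    · refine congrArg _ (funext ?_)
      rintro (v | v | v) <;> simp [bounds]
  · rw [Finset.sum_congr rfl (g := fun _ => typeSum lam mu m (t - 1) (j + 1)) fun w _ => ?_]
    · simp
    · refine boundSum_eq_typeSum ?_
      rw [map_univ_sum, map_univ_sum, map_univ_of_notMem (V := Fin t) _ {w} 2]
      · simp [bounds, Multiset.map_const', Multiset.replicate_succ]
        rfl
      · intro v hv
        simp only [Finset.mem_singleton] at hv
        simp [bounds, hv]
  · rw [Finset.sum_congr rfl (g := fun _ => typeSum lam mu m t (j - 1)) fun w _ => ?_]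
    · simp
    -- The neighbour now has bound zero; an isolated vertex of weight one is put on the other side
    -- to match it.
    · rw [typeSum,
        ← boundSum_elim_zero hl hm hl0 hm0 (bounds m t (j - 1))]
      refine boundSum_congr ?_
      rw [map_univ_sum, map_univ_sum, map_univ_of_notMem (V := Fin j) _ {w} 1,
        map_univ_sum (V := Fin m ⊕ Fin t ⊕ Fin (j - 1))]
      · simp [bounds, Multiset.map_const', map_univ_sum]
      · intro v hv
        simp only [Finset.mem_singleton] at hv
        simp [bounds, hv]

theorem sum_sym2_ite {ι M : Type} [Fintype ι] [DecidableEq ι] [CommRing M] (a b : M) :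
    ∑ e : Sym2 ι, (if e.IsDiag then a else b) =
      Fintype.card ι * a + (Fintype.card ι).choose 2 * b := by
  rw [Finset.sum_ite, Finset.sum_const, Finset.sum_const, ← Fintype.card_subtype,
    ← Fintype.card_subtype, Sym2.card_subtype_diag, Sym2.card_subtype_not_diag]
  simp

/-- Delete a vertex of bound two and classify the far ends of its edges as unbounded or of bound
two. A double edge exhausts a bound-two neighbour; two edges to different ones leave both with bound
one. -/
theorem typeSum_succ_left (hl : Summable lam) (hm : Summable mu) (hl0 : lam 0 = 1)
    (hm0 : mu 0 = 1) (m t : ℕ) :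
    typeSum lam mu m (t + 1) 0 = (1 + lam 1) * typeSum lam mu m t 0 +
      mu 1 * (m * typeSum lam mu m t 0 + t * typeSum lam mu m (t - 1) 1) +
      ((m * mu 2 + m.choose 2 * mu 1 ^ 2) * typeSum lam mu m t 0 +
        (t * mu 2 * typeSum lam mu m (t - 1) 0 +
          t.choose 2 * mu 1 ^ 2 * typeSum lam mu m (t - 2) 2) +
        m * t * mu 1 ^ 2 * typeSum lam mu m (t - 1) 1) := by
  let β : Fin m ⊕ Fin t → ℕ∞ := Sum.elim (fun _ => ⊤) fun _ => 2
  have hβ : boundSum lam mu β = typeSum lam mu m t 0 := by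
    refine boundSum_eq_typeSum ?_
    simp [map_univ_sum, β, Multiset.map_const']
  have h0 : typeSum lam mu m (t + 1) 0 =
      boundSum lam mu (Sum.elim (fun _ : Unit => 2) β) := by
    symm
    refine boundSum_eq_typeSum ?_
    simp [map_univ_sum, β, Multiset.map_const', Multiset.replicate_succ]
  have hone : ∀ w : Fin t, Finset.univ.val.map
      (fun i => (2 : ℕ∞) - ((Pi.single w 1 : Fin t → ℕ) i : ℕ∞)) =
      1 ::ₘ Multiset.replicate (t - 1) 2 := fun w => by
    rw [map_univ_of_notMem (V := Fin t) _ {w} 2]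
    · simp
      rfl
    · intro v hv
      simp only [Finset.mem_singleton] at hv
      simp [hv]
  have hmt : ∀ w : Fin t, boundSum lam mu (Sum.elim (fun _ : Fin m => ⊤)
      fun i => (2 : ℕ∞) - ((Pi.single w 1 : Fin t → ℕ) i : ℕ∞)) =
        typeSum lam mu m (t - 1) 1 := fun w => by
    refine boundSum_eq_typeSum ?_
    rw [map_univ_sum]
    simp only [Sum.elim_inl, Sum.elim_inr, hone, Multiset.map_const', Multiset.replicate_succ,
      Multiset.replicate_zero, Finset.card_val, Finset.card_univ, Fintype.card_fin,
      ← Multiset.singleton_add]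
    abel
  have htt : ∀ e : Sym2 (Fin t), boundSum lam mu (Sum.elim (fun _ : Fin m => ⊤)
      fun i => (2 : ℕ∞) - (pairCount e i : ℕ∞)) = if e.IsDiag then typeSum lam mu m (t - 1) 0
        else typeSum lam mu m (t - 2) 2 := fun e => by
    induction e with | _ a b
    by_cases hab : a = b
    · subst hab
      rw [if_pos (Sym2.mk_isDiag_iff.2 rfl), typeSum,
        ← boundSum_elim_zero hl hm hl0 hm0 (bounds m (t - 1) 0)]
      refine boundSum_congr ?_
      rw [map_univ_sum, map_univ_of_notMem (V := Fin t) _ {a} 2,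
        map_univ_sum (V := Fin m ⊕ Fin (t - 1) ⊕ Fin 0)]
      · simp [bounds, pairCount_mk, Multiset.map_const', map_univ_sum]
        norm_num
      · intro v hv
        simp only [Finset.mem_singleton] at hv
        simp [pairCount_mk, hv]
    · rw [if_neg (by simpa using hab)]
      refine boundSum_eq_typeSum ?_
      rw [map_univ_sum, map_univ_of_notMem (V := Fin t) _ {a, b} 2]
      · have hba : b ≠ a := fun h => hab h.symm
        simp [pairCount_mk, Multiset.map_const', hab, hba, Multiset.replicate_succ]
        simp only [show (2 : ℕ∞) - 1 = 1 from rfl, ← Multiset.singleton_add]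
        abel
      · intro v hv
        simp only [Finset.mem_insert, Finset.mem_singleton, not_or] at hv
        simp [pairCount_mk, hv.1, hv.2]
  have s1 : ∀ w : Fin m, (fun v => β v - ((Pi.single (Sum.inl w) 1 : Fin m ⊕ Fin t → ℕ) v : ℕ∞)) =
      β := fun w => by
    funext v
    rcases v with v | v <;> simp [β]
  have s2 : ∀ w : Fin t, (fun v => β v - ((Pi.single (Sum.inr w) 1 : Fin m ⊕ Fin t → ℕ) v : ℕ∞)) =
      Sum.elim (fun _ : Fin m => ⊤) fun i => (2 : ℕ∞) - ((Pi.single w 1 : Fin t → ℕ) i : ℕ∞) :=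
    fun w => by
      funext v
      rcases v with v | v <;> simp [β, Pi.single_apply]
  have p1 : ∀ e : Sym2 (Fin m), (fun v => β v - (pairCount (e.map Sum.inl) v : ℕ∞)) = β :=
    fun e => by
      induction e with | _ a b
      funext v
      rcases v with v | v <;> simp [β, pairCount_mk]
  have p2 : ∀ e : Sym2 (Fin t), (fun v => β v - (pairCount (e.map Sum.inr) v : ℕ∞)) =
      Sum.elim (fun _ : Fin m => ⊤) fun i => (2 : ℕ∞) - (pairCount e i : ℕ∞) := fun e => by
    induction e with | _ a b
    funext v
    rcases v with v | v <;> simp [β, pairCount_mk, Pi.single_apply]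
  have p3 : ∀ p : Fin m × Fin t, (fun v => β v - (pairCount s(Sum.inl p.1, Sum.inr p.2) v : ℕ∞)) =
      Sum.elim (fun _ : Fin m => ⊤) fun i => (2 : ℕ∞) - ((Pi.single p.2 1 : Fin t → ℕ) i : ℕ∞) :=
    fun p => by
      funext v
      rcases v with v | v
      · exact ENat.top_sub_natCast _
      · simp [β, pairCount_mk, Pi.single_apply]
  have d1 : ∀ e : Sym2 (Fin m), (e.map (Sum.inl : Fin m → Fin m ⊕ Fin t)).IsDiag ↔ e.IsDiag :=
    fun e => by induction e with | _ a b; simp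
  have d2 : ∀ e : Sym2 (Fin t), (e.map (Sum.inr : Fin t → Fin m ⊕ Fin t)).IsDiag ↔ e.IsDiag :=
    fun e => by induction e with | _ a b; simp
  rw [h0, boundSum_elim_two hl hm hl0 hm0 _ (by rintro (v | v) <;> simp [β]),
    Fintype.sum_sum_type, sum_sym2_sum]
  simp only [s1, s2, p1, p2, p3, d1, d2, hβ, hmt, htt]
  have h4 : ∑ e : Sym2 (Fin m), (if e.IsDiag then mu 2 else mu 1 ^ 2) * typeSum lam mu m t 0 =
      (m * mu 2 + m.choose 2 * mu 1 ^ 2) * typeSum lam mu m t 0 := by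
    rw [← Finset.sum_mul, sum_sym2_ite, Fintype.card_fin]
  have h3 : ∑ e : Sym2 (Fin t), (if e.IsDiag then mu 2 else mu 1 ^ 2) *
      (if e.IsDiag then typeSum lam mu m (t - 1) 0 else typeSum lam mu m (t - 2) 2) =
      t * mu 2 * typeSum lam mu m (t - 1) 0 +
          t.choose 2 * mu 1 ^ 2 * typeSum lam mu m (t - 2) 2 := by
    simp only [ite_mul_ite]
    rw [sum_sym2_ite]
    simp [mul_assoc]
  rw [h3, h4]
  simp only [Sym2.mk_isDiag_iff, reduceCtorEq, if_false, Finset.sum_const, Finset.card_univ,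
    Fintype.card_prod, Fintype.card_fin, nsmul_eq_mul, Nat.cast_mul]
  ring

/-- Inclusion-exclusion over the set of vertices required to have degree at most two; the summand
depends only on its cardinality `t`. -/
theorem allSum_three_le (hl : Summable lam) (hm : Summable mu) (n : ℕ) :
    allSum lam mu (fun d => 3 ≤ d) (Fin n) = ∑ t ∈ Finset.range (n + 1),
      n.choose t • ((-1) ^ t * typeSum lam mu (n - t) t 0) := by
  classical
  have h1 : ∀ T : Finset (Fin n), typeSum lam mu (n - T.card) T.card 0 =
      boundSum lam mu fun v => if v ∈ T then 2 else ⊤ := fun T => by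
    symm
    have h0 : T.val.map (fun v => if v ∈ T then (2 : ℕ∞) else ⊤) = T.val.map fun _ => 2 :=
      Multiset.map_congr rfl fun v hv => if_pos hv
    refine boundSum_eq_typeSum ?_
    rw [map_univ_of_notMem _ T ⊤ (fun v hv => if_neg hv), h0]
    simp [Multiset.map_const', add_comm]
  have h2 := Finset.sum_powerset_apply_card
    (f := fun t => (-1) ^ t * typeSum lam mu (n - t) t 0) (x := (Finset.univ : Finset (Fin n)))
  rw [Finset.card_univ, Fintype.card_fin] at h2
  rw [← h2]
  simp only [h1, boundSum, wsum, allSum]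
  rw [Finset.sum_congr rfl fun T _ => ((summable_omega_ite hl hm _).tsum_mul_left _).symm]
  rw [← Summable.tsum_finsetSum fun T _ => (summable_omega_ite hl hm _).mul_left _]
  refine tsum_congr fun G => ?_
  -- Expanding `∏ (1 - [deg v ≤ 2])` gives the signed sum over subsets, while the product itself is
  -- the indicator of minimum degree three.
  have h3 := Finset.prod_add (fun v : Fin n => if G.degree v ≤ 2 then (-1 : R) else 0) (fun _ => 1)
    Finset.univ
  have h4 : ∀ v, (if G.degree v ≤ 2 then (-1 : R) else 0) + 1 = if 3 ≤ G.degree v then 1 else 0 :=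
    fun v => by
      by_cases h : G.degree v ≤ 2
      · rw [if_pos h, if_neg (by omega)]
        ring
      · rw [if_neg h, if_pos (by omega)]
        ring
  simp only [h4, Finset.prod_const_one, mul_one, Finset.prod_ite_zero, Finset.mem_univ,
    true_imp_iff] at h3
  have h5 : (if ∀ v, 3 ≤ G.degree v then omega lam mu G else 0) =
      (if ∀ v, 3 ≤ G.degree v then (1 : R) else 0) * omega lam mu G := by
    split_ifs <;> simp
  have h6 : ∀ T : Finset (Fin n), (∀ v, (G.degree v : ℕ∞) ≤ if v ∈ T then 2 else ⊤) ↔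
      ∀ v ∈ T, G.degree v ≤ 2 := fun T => by
    refine forall_congr' fun v => ?_
    by_cases hv : v ∈ T
    · simp only [hv, if_true, true_imp_iff]
      exact_mod_cast Iff.rfl
    · simp [hv]
  trans ∑ T ∈ Finset.univ.powerset,
    (if ∀ v ∈ T, G.degree v ≤ 2 then ∏ _v ∈ T, (-1 : R) else 0) * omega lam mu G
  · rw [← Finset.sum_mul]
    convert! h5.trans (congrArg (· * omega lam mu G) h3)
  refine Finset.sum_congr rfl fun T _ => ?_
  rw [Finset.prod_const]
  by_cases h : ∀ v ∈ T, G.degree v ≤ 2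
  · rw [if_pos ((h6 T).2 h), if_pos h]
  · rw [if_neg (mt (h6 T).1 h), if_neg h, zero_mul, mul_zero]

end Counts

end Multigraph

/-! ### The topology of formal power series -/

/-- The discrete uniform structure on the coefficients. -/
@[reducible] def discreteRat : UniformSpace ℚ := ⊥

theorem discreteRat_discrete : @DiscreteUniformity ℚ discreteRat :=
  @DiscreteUniformity.mk ℚ discreteRat rfl

attribute [local instance] discreteRat discreteRat_discrete

open scoped MvPowerSeries.WithPiTopology

section Topology

variable {σ : Type}

theorem nonarchimedeanRing_mvPowerSeries : NonarchimedeanRing (MvPowerSeries σ ℚ) where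
  is_nonarchimedean U hU := by
    obtain ⟨N, hN, hNU⟩ := (IsLinearTopology.hasBasis_open_submodule
      (MvPowerSeries σ ℚ) (M := MvPowerSeries σ ℚ)).mem_iff.1 hU
    exact ⟨⟨N.toAddSubgroup, hN⟩, hNU⟩

attribute [local instance] nonarchimedeanRing_mvPowerSeries

/-- With discrete coefficients, summability is the formal condition that each coefficient receives
finitely many contributions. -/
theorem summable_of_finite_coeff {ι : Type} {f : ι → MvPowerSeries σ ℚ}
    (h : ∀ d, {i | MvPowerSeries.coeff d (f i) ≠ 0}.Finite) : Summable f :=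
  MvPowerSeries.WithPiTopology.summable_iff_summable_coeff.2 fun d =>
    summable_of_hasFiniteSupport (h d)

theorem finite_coeff_of_summable {ι : Type} {f : ι → MvPowerSeries σ ℚ} (h : Summable f)
    (d : σ →₀ ℕ) : {i | MvPowerSeries.coeff d (f i) ≠ 0}.Finite :=
  (MvPowerSeries.WithPiTopology.summable_iff_summable_coeff.1 h d).hasFiniteSupport_of_discreteTopology

theorem hasSum_subst {f : MvPowerSeries σ ℚ} (hf : MvPowerSeries.constantCoeff f = 0)
    (P : PowerSeries ℚ) :
    HasSum (fun n => PowerSeries.coeff n P • f ^ n) (PowerSeries.subst f P) := by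
  have hs : PowerSeries.HasSubst f := PowerSeries.HasSubst.of_constantCoeff_zero hf
  rw [MvPowerSeries.WithPiTopology.hasSum_iff_hasSum_coeff]
  intro d
  have h := PowerSeries.coeff_subst_finite hs P d
  have h2 : HasSum (fun n => PowerSeries.coeff n P • MvPowerSeries.coeff d (f ^ n))
      (∑' n, PowerSeries.coeff n P • MvPowerSeries.coeff d (f ^ n)) :=
    (summable_of_hasFiniteSupport h).hasSum
  rw [tsum_eq_finsum h, ← PowerSeries.coeff_subst hs] at h2
  exact h2

theorem continuous_pderiv (i : σ) : Continuous (MvPowerSeries.pderiv ℚ i) := by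
  refine continuous_pi fun d => ?_
  change Continuous fun f => MvPowerSeries.coeff d (MvPowerSeries.pderiv ℚ i f)
  simp only [MvPowerSeries.coeff_pderiv]
  exact (MvPowerSeries.WithPiTopology.continuous_coeff ℚ _).mul continuous_const

/-- The chain rule, by termwise differentiation of `∑ c_n f ^ n`, which is legitimate because
`pderiv` is continuous. -/
theorem pderiv_subst {f : MvPowerSeries σ ℚ} (hf : MvPowerSeries.constantCoeff f = 0)
    (P : PowerSeries ℚ) (i : σ) :
    MvPowerSeries.pderiv ℚ i (PowerSeries.subst f P) =
      PowerSeries.subst f (PowerSeries.derivative ℚ P) * MvPowerSeries.pderiv ℚ i f := by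
  have h1 := (hasSum_subst hf P).map (MvPowerSeries.pderiv ℚ i) (continuous_pderiv i)
  have h2 := (hasSum_subst hf (PowerSeries.derivative ℚ P)).mul_right (MvPowerSeries.pderiv ℚ i f)
  rw [← hasSum_nat_add_iff' 1] at h1
  refine HasSum.unique ?_ h2
  convert! h1 using 1
  · funext n
    simp only [Function.comp_apply, PowerSeries.coeff_derivative, Derivation.map_smul,
      Derivation.leibniz_pow, Nat.add_sub_cancel]
    simp only [smul_eq_mul, MvPowerSeries.smul_eq_C_mul, map_mul, map_add, map_one, map_natCast,
      nsmul_eq_mul]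
    push_cast
    ring
  · simp

end Topology

/-! ### Exponential and logarithm -/

section Exp

variable {σ : Type} {f g : MvPowerSeries σ ℚ}

theorem pderiv_expS (hf : MvPowerSeries.constantCoeff f = 0) (i : σ) :
    MvPowerSeries.pderiv ℚ i (expS f) = expS f * MvPowerSeries.pderiv ℚ i f := by
  rw [expS, pderiv_subst hf, PowerSeries.derivative_exp]

theorem one_add_mul_pderiv_logOneAdd (hf : MvPowerSeries.constantCoeff f = 0) (i : σ) :
    (1 + f) * MvPowerSeries.pderiv ℚ i (logOneAdd f) = MvPowerSeries.pderiv ℚ i f := by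
  have hs : PowerSeries.HasSubst f := PowerSeries.HasSubst.of_constantCoeff_zero hf
  have h1 : (1 + PowerSeries.X) * PowerSeries.derivative ℚ (PowerSeries.log ℚ) = 1 := by
    rw [PowerSeries.deriv_log, add_mul, one_mul]
    ext n
    rcases n with _ | n
    · simp
    · simp [PowerSeries.coeff_succ_X_mul, pow_succ, PowerSeries.coeff_one]
  have h2 := congrArg (PowerSeries.substAlgHom hs) h1
  simp only [map_mul, map_add, map_one, PowerSeries.substAlgHom_X, PowerSeries.coe_substAlgHom]
    at h2
  rw [logOneAdd, pderiv_subst hf, ← mul_assoc, h2, one_mul]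

theorem constantCoeff_expS (hf : MvPowerSeries.constantCoeff f = 0) :
    MvPowerSeries.constantCoeff (expS f) = 1 := by
  have hs : PowerSeries.HasSubst f := PowerSeries.HasSubst.of_constantCoeff_zero hf
  have h := PowerSeries.constantCoeff_subst_eq_zero hf (PowerSeries.exp ℚ - 1) (by simp)
  rw [PowerSeries.subst_sub hs, map_sub, sub_eq_zero] at h
  rw [expS, h, ← PowerSeries.coe_substAlgHom hs, map_one, map_one]

/-- All partial derivatives of the product vanish, so it equals its constant term; `expS_add` uses
the same device. -/
theorem expS_mul_expS_neg (hf : MvPowerSeries.constantCoeff f = 0) :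
    expS f * expS (-f) = 1 := by
  have hf' : MvPowerSeries.constantCoeff (-f) = 0 := by simp [hf]
  refine MvPowerSeries.pderiv.ext (fun i => ?_) ?_
  · rw [Derivation.leibniz, pderiv_expS hf, pderiv_expS hf', map_neg, MvPowerSeries.pderiv_one]
    simp only [smul_eq_mul]
    ring
  · rw [map_mul, constantCoeff_expS hf, constantCoeff_expS hf', map_one, one_mul]

theorem expS_add (hf : MvPowerSeries.constantCoeff f = 0)
    (hg : MvPowerSeries.constantCoeff g = 0) : expS (f + g) = expS f * expS g := by
  have hf' : MvPowerSeries.constantCoeff (-f) = 0 := by simp [hf]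
  have hg' : MvPowerSeries.constantCoeff (-g) = 0 := by simp [hg]
  have hfg : MvPowerSeries.constantCoeff (f + g) = 0 := by simp [hf, hg]
  have h : expS (f + g) * (expS (-f) * expS (-g)) = 1 := by
    refine MvPowerSeries.pderiv.ext (fun i => ?_) ?_
    · rw [Derivation.leibniz, Derivation.leibniz, pderiv_expS hf', pderiv_expS hg',
        pderiv_expS hfg, map_neg, map_neg, map_add, MvPowerSeries.pderiv_one]
      simp only [smul_eq_mul]
      ring
    · rw [map_mul, map_mul, constantCoeff_expS hf', constantCoeff_expS hg',
        constantCoeff_expS hfg, map_one, one_mul, one_mul]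
  linear_combination (expS f * expS g) * h - expS (f + g) * expS_mul_expS_neg hf *
    expS g * expS (-g) - expS (f + g) * expS_mul_expS_neg hg

theorem expS_zero : expS (0 : MvPowerSeries σ ℚ) = 1 := by
  have h := expS_add (f := (0 : MvPowerSeries σ ℚ)) (g := 0) (map_zero _) (map_zero _)
  have h2 := expS_mul_expS_neg (f := (0 : MvPowerSeries σ ℚ)) (map_zero _)
  rw [neg_zero] at h2
  rw [add_zero] at h
  rw [h, h2]

theorem expS_nsmul (hf : MvPowerSeries.constantCoeff f = 0) (n : ℕ) :
    expS (n • f) = expS f ^ n := by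
  induction n with
  | zero => rw [zero_smul, expS_zero, pow_zero]
  | succ n ih => rw [succ_nsmul, expS_add (by simp [hf]) hf, ih, pow_succ]

/-- Differentiate the equality and cancel the unit `expS g`: all partial derivatives agree, as do
the constant terms. -/
theorem expS_injective (hf : MvPowerSeries.constantCoeff f = 0)
    (hg : MvPowerSeries.constantCoeff g = 0) (h : expS f = expS g) : f = g := by
  refine MvPowerSeries.pderiv.ext (fun i => ?_) (hf.trans hg.symm)
  have h1 := congrArg (MvPowerSeries.pderiv ℚ i) h
  rw [pderiv_expS hf, pderiv_expS hg, h] at h1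
  have h2 := expS_mul_expS_neg hg
  linear_combination (expS (-g)) * h1 -
    (MvPowerSeries.pderiv ℚ i f - MvPowerSeries.pderiv ℚ i g) * h2

theorem hasSum_expS (hf : MvPowerSeries.constantCoeff f = 0) :
    HasSum (fun n : ℕ => ((1 / n.factorial : ℚ)) • f ^ n) (expS f) := by
  have := hasSum_subst hf (PowerSeries.exp ℚ)
  simpa [PowerSeries.coeff_exp, expS] using this

theorem dvd_subst (hf : MvPowerSeries.constantCoeff f = 0) {P : PowerSeries ℚ}
    (hP : PowerSeries.constantCoeff P = 0) : f ∣ PowerSeries.subst f P := by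
  have hs : PowerSeries.HasSubst f := PowerSeries.HasSubst.of_constantCoeff_zero hf
  obtain ⟨Q, rfl⟩ := PowerSeries.X_dvd_iff.2 hP
  rw [PowerSeries.subst_mul hs, PowerSeries.subst_X hs]
  exact dvd_mul_right _ _

theorem dvd_expS_sub_one (hf : MvPowerSeries.constantCoeff f = 0) : f ∣ expS f - 1 := by
  have hs : PowerSeries.HasSubst f := PowerSeries.HasSubst.of_constantCoeff_zero hf
  have h := dvd_subst hf (P := PowerSeries.exp ℚ - 1) (by simp)
  rw [PowerSeries.subst_sub hs, ← PowerSeries.coe_substAlgHom hs, map_one] at h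
  rwa [expS, ← PowerSeries.coe_substAlgHom hs]

theorem dvd_logOneAdd (hf : MvPowerSeries.constantCoeff f = 0) : f ∣ logOneAdd f :=
  dvd_subst hf (by simp)

/-- A linear differential equation has at most one solution with given terms without `X i`. -/
theorem eq_of_pderiv_eq_mul (i : σ) {u A B : MvPowerSeries σ ℚ}
    (hA : MvPowerSeries.pderiv ℚ i A = u * A) (hB : MvPowerSeries.pderiv ℚ i B = u * B)
    (h0 : (MvPowerSeries.X i : MvPowerSeries σ ℚ) ∣ A - B) : A = B := by
  classical
  set H := A - B with hH
  have hd : MvPowerSeries.pderiv ℚ i H = u * H := by rw [hH, map_sub, hA, hB, mul_sub]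
  -- Induction on the exponent of `X i`: a coefficient of `pderiv H` at exponent `n` is a nonzero
  -- multiple of one of `H` at exponent `n + 1`, while `u * H` there uses only coefficients of `H`
  -- with exponent at most `n`.
  suffices hz : ∀ n : ℕ, ∀ d : σ →₀ ℕ, d i = n → MvPowerSeries.coeff d H = 0 by
    rw [← sub_eq_zero, ← hH]
    ext d
    simpa using hz _ d rfl
  intro n
  induction n using Nat.strong_induction_on with
  | _ n ih =>
    intro d hdi
    rcases n with _ | n
    · exact (MvPowerSeries.X_dvd_iff.1 h0) d hdi
    · have hle : Finsupp.single i 1 ≤ d := by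
        rw [Finsupp.single_le_iff, hdi]
        omega
      have h1 := congrArg (MvPowerSeries.coeff (d - Finsupp.single i 1)) hd
      rw [MvPowerSeries.coeff_pderiv, tsub_add_cancel_of_le hle, MvPowerSeries.coeff_mul,
        Finset.sum_eq_zero] at h1
      · refine (mul_eq_zero.1 h1).resolve_right ?_
        positivity
      · intro p hp
        have h2 := DFunLike.congr_fun (Finset.HasAntidiagonal.mem_antidiagonal.1 hp) i
        simp only [Finsupp.coe_add, Pi.add_apply, Finsupp.coe_tsub, Pi.sub_apply,
          Finsupp.single_eq_same, hdi] at h2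
        rw [ih (p.2 i) (by omega) p.2 rfl, mul_zero]

end Exp

open scoped MvPowerSeries.WithPiTopology
attribute [local instance] discreteRat discreteRat_discrete nonarchimedeanRing_mvPowerSeries

/-! ### Exponential generating functions -/

section Egf

variable {σ : Type} (i : σ)

theorem summable_of_X_pow_dvd {ι : Type} {f : ι → MvPowerSeries σ ℚ} {e : ι → ℕ}
    (he : ∀ n, {k | e k ≤ n}.Finite)
    (h : ∀ k, (MvPowerSeries.X i : MvPowerSeries σ ℚ) ^ e k ∣ f k) : Summable f :=
  summable_of_finite_coeff fun d => (he (d i)).subset fun k hk => by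
    by_contra hlt
    exact hk (MvPowerSeries.X_pow_dvd_iff.1 (h k) d (not_le.1 hlt))

/-- The exponential generating function `∑ a n x ^ n / n!`, `x = X i`. -/
noncomputable def egf (a : ℕ → MvPowerSeries σ ℚ) : MvPowerSeries σ ℚ :=
  ∑' n : ℕ, (1 / n.factorial : ℚ) • (MvPowerSeries.X i ^ n * a n)

theorem hasSum_egf (a : ℕ → MvPowerSeries σ ℚ) :
    HasSum (fun n : ℕ => (1 / n.factorial : ℚ) • (MvPowerSeries.X i ^ n * a n)) (egf i a) :=
  (summable_of_X_pow_dvd i (e := id) (fun n => Set.finite_Iic n) fun _ =>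
    dvd_smul_of_dvd _ (dvd_mul_right _ _)).hasSum

theorem egf_add (a b : ℕ → MvPowerSeries σ ℚ) :
    egf i (fun n => a n + b n) = egf i a + egf i b := by
  refine (hasSum_egf i _).unique ?_
  refine ((hasSum_egf i a).add (hasSum_egf i b)).congr_fun fun n => ?_
  rw [mul_add, smul_add]

theorem egf_mul_left (c : MvPowerSeries σ ℚ) (a : ℕ → MvPowerSeries σ ℚ) :
    egf i (fun n => c * a n) = c * egf i a := by
  refine (hasSum_egf i _).unique ?_
  refine ((hasSum_egf i a).mul_left c).congr_fun fun n => ?_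
  rw [mul_smul_comm, mul_left_comm]

theorem egf_neg (a : ℕ → MvPowerSeries σ ℚ) : egf i (fun n => -a n) = -egf i a := by
  simpa using egf_mul_left i (-1) a

theorem inv_factorial_succ (n : ℕ) :
    (1 / (n + 1).factorial : ℚ) * (n + 1 : ℕ) = 1 / n.factorial := by
  rw [Nat.factorial_succ]
  push_cast
  have : (n : ℚ) + 1 ≠ 0 := by positivity
  field_simp

/-- The value of `a (n - 1)` at `n = 0` is irrelevant because of the factor `n`. -/
theorem X_mul_egf (a : ℕ → MvPowerSeries σ ℚ) :
    MvPowerSeries.X i * egf i a = egf i fun n => n * a (n - 1) := by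
  refine HasSum.unique ((hasSum_egf i a).mul_left (MvPowerSeries.X i)) ?_
  have h := hasSum_egf i fun n => n * a (n - 1)
  rw [← hasSum_nat_add_iff' 1] at h
  convert! h using 1
  · funext n
    rw [Nat.add_sub_cancel, mul_smul_comm, ← inv_factorial_succ, mul_smul, Nat.cast_smul_eq_nsmul,
      nsmul_eq_mul]
    congr 1
    ring
  · simp

theorem pderiv_egf {a : ℕ → MvPowerSeries σ ℚ} (ha : ∀ n, MvPowerSeries.pderiv ℚ i (a n) = 0) :
    MvPowerSeries.pderiv ℚ i (egf i a) = egf i fun n => a (n + 1) := by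
  have h := (hasSum_egf i a).map (MvPowerSeries.pderiv ℚ i) (continuous_pderiv i)
  rw [← hasSum_nat_add_iff' 1] at h
  refine HasSum.unique ?_ (hasSum_egf i _)
  convert! h using 1
  · funext n
    simp only [Function.comp_apply, Derivation.map_smul, Derivation.leibniz, ha,
      Derivation.leibniz_pow, MvPowerSeries.pderiv_X_self, Nat.add_sub_cancel]
    rw [← inv_factorial_succ, mul_smul, Nat.cast_smul_eq_nsmul]
    congr 1
    simp only [smul_eq_mul, nsmul_eq_mul]
    ring
  · simp [ha]

theorem X_dvd_egf_sub (a : ℕ → MvPowerSeries σ ℚ) : MvPowerSeries.X i ∣ egf i a - a 0 := by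
  have h := hasSum_egf i a
  rw [← hasSum_nat_add_iff' 1] at h
  have h2 : HasSum (fun n : ℕ => MvPowerSeries.X i *
      ((1 / (n + 1).factorial : ℚ) • (MvPowerSeries.X i ^ n * a (n + 1)))) (egf i a - a 0) := by
    convert! h using 1
    · funext n
      rw [mul_smul_comm, pow_succ']
      congr 1
      ring
    · simp
  rw [MvPowerSeries.X_dvd_iff]
  intro d hd
  have h3 := MvPowerSeries.WithPiTopology.hasSum_iff_hasSum_coeff.1 h2 d
  refine h3.unique (hasSum_zero.congr_fun fun n => ?_)
  exact MvPowerSeries.X_dvd_iff.1 (Dvd.intro _ rfl) d hd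

/-- A double sum over `m` and `t` regrouped along `m + t = n`. Inclusion-exclusion needs this
general form because its summand is not a product of a function of `m` and a function of `t`. -/
theorem hasSum_egf_egf (b : ℕ → ℕ → MvPowerSeries σ ℚ) :
    HasSum (fun m : ℕ => (1 / m.factorial : ℚ) • (MvPowerSeries.X i ^ m * egf i (b m)))
      (egf i fun n => ∑ t ∈ Finset.range (n + 1), n.choose t • b (n - t) t) := by
  let F : ℕ × ℕ → MvPowerSeries σ ℚ := fun p =>
    ((1 / p.1.factorial : ℚ) * (1 / p.2.factorial : ℚ)) •
      (MvPowerSeries.X i ^ (p.1 + p.2) * b p.1 p.2)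
  have hF : Summable F := by
    refine summable_of_X_pow_dvd i (e := fun p => p.1 + p.2) (fun n => ?_) fun p =>
      dvd_smul_of_dvd _ (dvd_mul_right _ _)
    refine ((Set.finite_Iic n).prod (Set.finite_Iic n)).subset fun p hp => ?_
    have : p.1 + p.2 ≤ n := hp
    exact ⟨by simp; omega, by simp; omega⟩
  have h1 : HasSum (fun m : ℕ => (1 / m.factorial : ℚ) • (MvPowerSeries.X i ^ m * egf i (b m)))
      (∑' p, F p) := by
    refine hF.hasSum.prod_fiberwise fun m => ?_
    refine (((hasSum_egf i (b m)).mul_left (MvPowerSeries.X i ^ m)).const_smul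
      (1 / m.factorial : ℚ)).congr_fun fun t => ?_
    simp only [F]
    rw [mul_smul_comm, mul_smul, pow_add, mul_assoc]
  have h2 : ∑' p, F p =
      egf i fun n => ∑ t ∈ Finset.range (n + 1), n.choose t • b (n - t) t := by
    have hF' := Finset.HasAntidiagonal.sigmaAntidiagonalEquivProd.summable_iff.2 hF
    rw [← Finset.HasAntidiagonal.sigmaAntidiagonalEquivProd.tsum_eq F]
    refine hF'.tsum_sigma.trans ?_
    rw [egf]
    refine tsum_congr fun n => ?_
    rw [tsum_fintype, Finset.mul_sum, Finset.smul_sum]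
    trans ∑ p ∈ Finset.HasAntidiagonal.antidiagonal n, F p
    · exact Finset.sum_coe_sort (Finset.HasAntidiagonal.antidiagonal n) F
    · rw [← Finset.Nat.sum_antidiagonal_swap, Finset.Nat.sum_antidiagonal_eq_sum_range_succ_mk]
      refine Finset.sum_congr rfl fun t ht => ?_
      have htn : t ≤ n := Nat.lt_succ_iff.1 (Finset.mem_range.1 ht)
      simp only [F, Prod.swap_prod_mk, Nat.sub_add_cancel htn]
      rw [mul_smul_comm, ← Nat.cast_smul_eq_nsmul ℚ, smul_smul]
      congr 1
      rw [Nat.cast_choose ℚ htn]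
      have : (n.factorial : ℚ) ≠ 0 := by positivity
      field_simp
  rw [← h2]
  exact h1

theorem egf_mul (a b : ℕ → MvPowerSeries σ ℚ) :
    egf i (fun n => ∑ t ∈ Finset.range (n + 1), n.choose t • (a (n - t) * b t)) =
      egf i a * egf i b := by
  refine (hasSum_egf_egf i fun m t => a m * b t).unique ?_
  refine ((hasSum_egf i a).mul_right (egf i b)).congr_fun fun m => ?_
  rw [egf_mul_left, smul_mul_assoc, mul_assoc]

end Egf

/-! ### Weighted multigraphs -/

namespace Multigraph

section

variable {σ : Type} {i : σ} {lam mu : ℕ → MvPowerSeries σ ℚ}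

theorem pderiv_wsum (hl : Summable lam) (hm : Summable mu)
    (hld : ∀ k, MvPowerSeries.pderiv ℚ i (lam k) = 0)
    (hmd : ∀ k, MvPowerSeries.pderiv ℚ i (mu k) = 0)
    {V : Type} [Fintype V] [DecidableEq V] (p : Multigraph V → Prop) :
    MvPowerSeries.pderiv ℚ i (wsum lam mu p) = 0 := by
  classical
  rw [wsum, (summable_omega_ite hl hm p).map_tsum (MvPowerSeries.pderiv ℚ i) (continuous_pderiv i)]
  refine (tsum_congr fun G => ?_).trans tsum_zero
  split_ifs
  · rw [omega]
    refine Finset.prod_induction _ (fun f => MvPowerSeries.pderiv ℚ i f = 0) ?_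
      MvPowerSeries.pderiv_one ?_
    · intro f g hf hg
      rw [Derivation.leibniz, hf, hg, smul_zero, smul_zero, add_zero]
    · intro e _
      rw [edgeWeight]
      split_ifs
      · exact hld _
      · exact hmd _
  · exact map_zero _

/-- The exponential formula. -/
theorem expS_egf_connSum (hl : Summable lam) (hm : Summable mu) (hm0 : mu 0 = 1)
    (hld : ∀ k, MvPowerSeries.pderiv ℚ i (lam k) = 0)
    (hmd : ∀ k, MvPowerSeries.pderiv ℚ i (mu k) = 0) (D : ℕ → Prop) :
    MvPowerSeries.constantCoeff (egf i fun n => connSum lam mu D (Fin n)) = 0 ∧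
    expS (egf i fun n => connSum lam mu D (Fin n)) = egf i fun n => allSum lam mu D (Fin n) := by
  classical
  -- The empty graph is not connected, but it is a multigraph of weight one; this fixes the initial
  -- value of the differential equation.
  have hc0 : connSum lam mu D (Fin 0) = 0 := by
    rw [connSum, wsum]
    refine (tsum_congr fun G => if_neg fun h => ?_).trans tsum_zero
    exact h.1.nonempty.elim fun v => v.elim0
  have ha0 : allSum lam mu D (Fin 0) = 1 := by
    rw [allSum, wsum, tsum_eq_single (fun _ => 0)]
    · rw [if_pos fun v => v.elim0, omega]
      simp
    · intro G hG
      refine absurd (funext fun e => ?_) hG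
      induction e with | _ a b
      exact a.elim0
  have hd := X_dvd_egf_sub i fun n => connSum lam mu D (Fin n)
  rw [hc0, sub_zero] at hd
  have hz : MvPowerSeries.constantCoeff (egf i fun n => connSum lam mu D (Fin n)) = 0 := by
    obtain ⟨q, hq⟩ := hd
    rw [hq]
    simp
  -- Both sides solve `F' = C' F` and have initial term one; for the right side the equation is
  -- `allSum_succ`.
  refine ⟨hz, eq_of_pderiv_eq_mul i
    (u := MvPowerSeries.pderiv ℚ i (egf i fun n => connSum lam mu D (Fin n))) ?_ ?_ ?_⟩
  · rw [pderiv_expS hz, mul_comm]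
  · rw [pderiv_egf i (a := fun n => allSum lam mu D (Fin n)) fun n =>
        pderiv_wsum hl hm hld hmd _,
      pderiv_egf i (a := fun n => connSum lam mu D (Fin n)) fun n =>
        pderiv_wsum hl hm hld hmd _, mul_comm, ← egf_mul]
    congr 1
    funext n
    rw [allSum_succ hl hm hm0]
    refine Finset.sum_congr rfl fun t _ => ?_
    rw [mul_comm]
  · have h1 := hd.trans (dvd_expS_sub_one hz)
    have h2 := X_dvd_egf_sub i fun n => allSum lam mu D (Fin n)
    rw [ha0] at h2
    simpa using dvd_sub h1 h2

end

end Multigraph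

/-! ### The vertices of degree at most two -/

namespace Multigraph

section

variable {σ : Type}

/-- `s = -x y² / (1 + x y)`. -/
noncomputable def chainSeries (x y : MvPowerSeries σ ℚ) : MvPowerSeries σ ℚ :=
  -(x * y ^ 2) * (1 + x * y)⁻¹

/-- The contribution of the components without vertices of unbounded degree. -/
noncomputable def closedExponent (x y l m : MvPowerSeries σ ℚ) : MvPowerSeries σ ℚ :=
  serE x y - x * l + (1 / 2 : ℚ) • (x ^ 2 * m)

/-- The contribution of the pendant paths and of the cycles at a vertex of unbounded degree. -/
noncomputable def vertexExponent (x y m : MvPowerSeries σ ℚ) : MvPowerSeries σ ℚ :=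
  -(x * (y + chainSeries x y)) - (1 / 2 : ℚ) • (chainSeries x y * x * y) - x * m

theorem dvd_chainSeries (x y : MvPowerSeries σ ℚ) : x ∣ chainSeries x y :=
  ((dvd_mul_right x _).neg_right).mul_right _

theorem dvd_vertexExponent (x y m : MvPowerSeries σ ℚ) : x ∣ vertexExponent x y m :=
  dvd_sub (dvd_sub (dvd_mul_right x _).neg_right
    (dvd_smul_of_dvd _ (((dvd_chainSeries x y).mul_right _).mul_right _))) (dvd_mul_right x _)

theorem dvd_serE {x : MvPowerSeries σ ℚ} (hx : MvPowerSeries.constantCoeff x = 0)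
    (y : MvPowerSeries σ ℚ) : x ∣ serE x y := by
  have hxy : MvPowerSeries.constantCoeff (x * y) = 0 := by simp [hx]
  refine dvd_sub (dvd_add (dvd_sub (dvd_add (dvd_refl x).neg_right ?_) ?_) ?_) ?_
  · exact ((dvd_pow_self x two_ne_zero).mul_right _).mul_right _
  · exact dvd_smul_of_dvd _ ((dvd_mul_right x y).trans (dvd_logOneAdd hxy))
  · exact dvd_smul_of_dvd _ (dvd_mul_right x y)
  · exact dvd_smul_of_dvd _ ((dvd_mul_right x y).trans (dvd_pow_self _ two_ne_zero))

theorem dvd_closedExponent {x : MvPowerSeries σ ℚ} (hx : MvPowerSeries.constantCoeff x = 0)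
    (y l m : MvPowerSeries σ ℚ) : x ∣ closedExponent x y l m :=
  dvd_add (dvd_sub (dvd_serE hx y) (dvd_mul_right x l))
    (dvd_smul_of_dvd _ ((dvd_pow_self x two_ne_zero).mul_right _))

theorem constantCoeff_eq_zero_of_dvd {x f : MvPowerSeries σ ℚ}
    (hx : MvPowerSeries.constantCoeff x = 0) (h : x ∣ f) :
    MvPowerSeries.constantCoeff f = 0 := by
  obtain ⟨q, rfl⟩ := h
  rw [map_mul, hx, zero_mul]

/-- Here `f`, `g`, `h` stand for the signed generating functions with zero, one and two vertices of
bound one. The relations `hg` and `hh` express `g` and `h` as multiples of `f`, so the recurrence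
for `f'` becomes `f' = Φ' f` for an explicit rational `Φ'`; the three exponents are chosen to
integrate it. -/
theorem pderiv_exponent (i : σ) {y l m : MvPowerSeries σ ℚ}
    (hy : MvPowerSeries.pderiv ℚ i y = 0) (hl : MvPowerSeries.pderiv ℚ i l = 0)
    (hm : MvPowerSeries.pderiv ℚ i m = 0) (n : ℕ) {f g h : MvPowerSeries σ ℚ}
    (hg : g + y * (MvPowerSeries.X i * g) = f + (n : MvPowerSeries σ ℚ) * y * f)
    (hh : h + y * (MvPowerSeries.X i * h) = g + (n : MvPowerSeries σ ℚ) * y * g + y * f) :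
    MvPowerSeries.pderiv ℚ i (closedExponent (MvPowerSeries.X i) y l m +
      n • vertexExponent (MvPowerSeries.X i) y m +
      n.choose 2 • chainSeries (MvPowerSeries.X i) y) * f =
    -((1 + l) * f + y * ((n : MvPowerSeries σ ℚ) * f - MvPowerSeries.X i * g) +
      (((n : MvPowerSeries σ ℚ) * m + (n.choose 2 : MvPowerSeries σ ℚ) * y ^ 2) * f -
        m * (MvPowerSeries.X i * f) -
        (n : MvPowerSeries σ ℚ) * y ^ 2 * (MvPowerSeries.X i * g)) +
      (1 / 2 : ℚ) • (y ^ 2 * (MvPowerSeries.X i * (MvPowerSeries.X i * h)))) := by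
  set x : MvPowerSeries σ ℚ := MvPowerSeries.X i with hx
  have hx1 : MvPowerSeries.pderiv ℚ i x = 1 := MvPowerSeries.pderiv_X_self
  have hxc : MvPowerSeries.constantCoeff x = 0 := by simp [hx]
  have hxy : MvPowerSeries.constantCoeff (x * y) = 0 := by simp [hxc]
  have hd2 : MvPowerSeries.pderiv ℚ i (2 : MvPowerSeries σ ℚ) = 0 :=
    (MvPowerSeries.pderiv ℚ i).map_natCast 2
  -- The inverse, the constant one half and the binomial coefficient become opaque symbols known
  -- only through `(1 + x y) I = 1`, `2 r = 1` and `2 c = n² - n`, so that the final identity is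
  -- polynomial.
  obtain ⟨I, hI⟩ : ∃ I, I = (1 + x * y)⁻¹ := ⟨_, rfl⟩
  have hI1 : (1 + x * y) * I = 1 := by
    rw [hI]
    exact MvPowerSeries.mul_inv_cancel _ (by simp [hxc])
  obtain ⟨r, hr⟩ : ∃ r : MvPowerSeries σ ℚ, r = MvPowerSeries.C (1 / 2 : ℚ) := ⟨_, rfl⟩
  have hr2 : 2 * r = 1 := by
    rw [hr, ← map_ofNat (MvPowerSeries.C (σ := σ) (R := ℚ)) 2, ← map_mul]
    norm_num
  have hr4 : MvPowerSeries.C (1 / 4 : ℚ) = r ^ 2 := by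
    rw [hr, ← map_pow]
    norm_num
  have hJ : (2 + 2 * x * y)⁻¹ = r * I := by
    have h1 : (2 + 2 * x * y) * (2 + 2 * x * y)⁻¹ = 1 :=
      MvPowerSeries.mul_inv_cancel _ (by simp [hxc, map_ofNat])
    linear_combination (r * I) * h1 - (2 + 2 * x * y)⁻¹ * (2 * r * hI1 + hr2)
  have hIs : chainSeries x y = -(x * y ^ 2) * I := by rw [hI]; rfl
  have hdI : MvPowerSeries.pderiv ℚ i I = -I ^ 2 * y := by
    rw [hI, MvPowerSeries.pderiv_inv', map_add, MvPowerSeries.pderiv_one, Derivation.leibniz,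
      hx1, hy]
    simp
  have hlog : MvPowerSeries.pderiv ℚ i (logOneAdd (x * y)) = y * I := by
    have h1 := one_add_mul_pderiv_logOneAdd hxy i
    rw [Derivation.leibniz, hx1, hy, smul_zero, zero_add, smul_eq_mul, mul_one] at h1
    linear_combination I * h1 - MvPowerSeries.pderiv ℚ i (logOneAdd (x * y)) * hI1
  obtain ⟨c, hc⟩ : ∃ c : MvPowerSeries σ ℚ, c = (n.choose 2 : ℕ) := ⟨_, rfl⟩
  have hc2 : 2 * c = (n : MvPowerSeries σ ℚ) * n - n := by
    have h1 : 2 * n.choose 2 + n = n * n := by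
      rw [Nat.choose_two_right, Nat.mul_div_cancel' (Nat.even_mul_pred_self n).two_dvd]
      rcases n with _ | n
      · rfl
      · rw [Nat.add_sub_cancel]
        ring
    rw [hc, ← Nat.cast_mul, ← h1]
    push_cast
    ring
  have hg' : g = (1 + (n : MvPowerSeries σ ℚ) * y) * I * f := by linear_combination I * hg - g * hI1
  have hh' : h = ((1 + (n : MvPowerSeries σ ℚ) * y) * g + y * f) * I := by
    linear_combination I * hh - h * hI1
  simp only [closedExponent, vertexExponent, serE, hIs, hJ, MvPowerSeries.smul_eq_C_mul, ← hr, hr4,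
    nsmul_eq_mul, ← hc]
  have hdr : MvPowerSeries.pderiv ℚ i r = 0 := by rw [hr, MvPowerSeries.pderiv_C]
  have hdc : MvPowerSeries.pderiv ℚ i c = 0 := by rw [hc, Derivation.map_natCast]
  simp only [map_add, map_sub, map_neg, Derivation.leibniz, Derivation.leibniz_pow, hx1, hy, hl,
    hm, hdI, hlog, hdr, hdc, Derivation.map_natCast, smul_eq_mul, nsmul_eq_mul, mul_zero,
    add_zero, zero_add, mul_one]
  rw [hh', hg']
  clear hg hh hg' hh' hIs hdI hlog hdr hdc hJ hx hx1 hI hr hr4 hxc hxy hy hl hm hd2 hc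
  push_cast
  generalize (n : MvPowerSeries σ ℚ) = N at *
  grind

theorem neg_one_pow_mul_pred {R : Type} [CommRing R] (q : ℕ → R) (t : ℕ) :
    (-1) ^ t * (t * q (t - 1)) = -((t : R) * ((-1) ^ (t - 1) * q (t - 1))) := by
  rcases t with _ | t
  · simp
  · rw [Nat.add_sub_cancel, pow_succ]
    ring

/-- Rewrites `t choose 2` as `t (t - 1) / 2`, the form in which two applications of `X_mul_egf` read
it as multiplication by `x² / 2`. -/
theorem neg_one_pow_mul_choose_two (q : ℕ → MvPowerSeries σ ℚ) (t : ℕ) :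
    (-1) ^ t * ((t.choose 2 : MvPowerSeries σ ℚ) * q (t - 2)) = MvPowerSeries.C (1 / 2 : ℚ) *
      ((t : MvPowerSeries σ ℚ) * (((t - 1 : ℕ) : MvPowerSeries σ ℚ) *
        ((-1) ^ (t - 1 - 1) * q (t - 1 - 1)))) := by
  rcases t with _ | _ | t
  · simp
  · simp
  · have h1 : ((t + 2).choose 2 : MvPowerSeries σ ℚ) = MvPowerSeries.C (1 / 2 : ℚ) *
        (((t + 2 : ℕ) : MvPowerSeries σ ℚ) * ((t + 1 : ℕ) : MvPowerSeries σ ℚ)) := by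
      rw [← map_natCast (MvPowerSeries.C (σ := σ) (R := ℚ)),
        ← map_natCast (MvPowerSeries.C (σ := σ) (R := ℚ)) (t + 2),
        ← map_natCast (MvPowerSeries.C (σ := σ) (R := ℚ)) (t + 1), ← map_mul, ← map_mul,
        Nat.cast_choose_two]
      congr 1
      push_cast
      ring
    rw [h1]
    simp only [Nat.add_sub_cancel, show t + 1 + 1 - 2 = t by omega, pow_succ]
    ring

variable {i : σ} {lam mu : ℕ → MvPowerSeries σ ℚ} {L Y : MvPowerSeries σ ℚ}

/-- The recurrences for deleting bounded vertices turn into a linear differential equation in `x`;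
at `t = 0` no vertex is bounded and the total is `L ^ n * Y ^ n.choose 2`. -/
theorem egf_typeSum (hl : HasSum lam L) (hm : HasSum mu Y) (hl0 : lam 0 = 1) (hm0 : mu 0 = 1)
    (hld : ∀ k, MvPowerSeries.pderiv ℚ i (lam k) = 0)
    (hmd : ∀ k, MvPowerSeries.pderiv ℚ i (mu k) = 0) (n : ℕ) :
    egf i (fun t => (-1) ^ t * typeSum lam mu n t 0) = L ^ n * Y ^ n.choose 2 *
      expS (closedExponent (MvPowerSeries.X i) (mu 1) (lam 1) (mu 2) +
        n • vertexExponent (MvPowerSeries.X i) (mu 1) (mu 2) +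
        n.choose 2 • chainSeries (MvPowerSeries.X i) (mu 1)) := by
  have hls := hl.summable
  have hms := hm.summable
  have hd0 : ∀ t j, MvPowerSeries.pderiv ℚ i (typeSum lam mu n t j) = 0 := fun t j =>
    pderiv_wsum hls hms hld hmd _
  have hd : ∀ t, MvPowerSeries.pderiv ℚ i ((-1) ^ t * typeSum lam mu n t 0) = 0 := fun t => by
    rw [Derivation.leibniz, hd0, Derivation.leibniz_pow, map_neg, MvPowerSeries.pderiv_one]
    simp
  set Φ := closedExponent (MvPowerSeries.X i) (mu 1) (lam 1) (mu 2) +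
        n • vertexExponent (MvPowerSeries.X i) (mu 1) (mu 2) +
        n.choose 2 • chainSeries (MvPowerSeries.X i) (mu 1) with hΦ
  have hX : MvPowerSeries.constantCoeff (MvPowerSeries.X i : MvPowerSeries σ ℚ) = 0 := by simp
  have hdvd : MvPowerSeries.X i ∣ Φ :=
    dvd_add (dvd_add (dvd_closedExponent hX _ _ _) (dvd_smul_of_dvd _ (dvd_vertexExponent _ _ _)))
      (dvd_smul_of_dvd _ (dvd_chainSeries _ _))
  have hΦ0 := constantCoeff_eq_zero_of_dvd hX hdvd
  -- This and `hh` are `typeSum_succ_right` at `j = 0` and `j = 1`; lowering `t` changes the sign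
  -- and multiplies by `x`.
  have hg : egf i (fun t => (-1) ^ t * typeSum lam mu n t 1) + mu 1 * (MvPowerSeries.X i *
      egf i (fun t => (-1) ^ t * typeSum lam mu n t 1)) =
      egf i (fun t => (-1) ^ t * typeSum lam mu n t 0) +
        (n : MvPowerSeries σ ℚ) * mu 1 * egf i (fun t => (-1) ^ t * typeSum lam mu n t 0) := by
    simp only [X_mul_egf]
    simp only [← egf_mul_left, ← egf_add]
    congr 1
    funext t
    have h1 := neg_one_pow_mul_pred (fun t => typeSum lam mu n t 1) t
    have h2 := typeSum_succ_right hls hms hl0 hm0 n t 0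
    simp only [zero_add, Nat.cast_zero, zero_mul, add_zero] at h2
    linear_combination (-1) ^ t * h2 + mu 1 * h1
  have hh : egf i (fun t => (-1) ^ t * typeSum lam mu n t 2) + mu 1 * (MvPowerSeries.X i *
      egf i (fun t => (-1) ^ t * typeSum lam mu n t 2)) =
      egf i (fun t => (-1) ^ t * typeSum lam mu n t 1) +
        (n : MvPowerSeries σ ℚ) * mu 1 * egf i (fun t => (-1) ^ t * typeSum lam mu n t 1) +
        mu 1 * egf i (fun t => (-1) ^ t * typeSum lam mu n t 0) := by
    simp only [X_mul_egf]
    simp only [← egf_mul_left, ← egf_add]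
    congr 1
    funext t
    have h1 := neg_one_pow_mul_pred (fun t => typeSum lam mu n t 2) t
    have h2 := typeSum_succ_right hls hms hl0 hm0 n t 1
    simp only [Nat.reduceAdd, Nat.cast_one, one_mul, Nat.sub_self] at h2
    linear_combination (-1) ^ t * h2 + mu 1 * h1
  refine eq_of_pderiv_eq_mul i (u := MvPowerSeries.pderiv ℚ i Φ) ?_ ?_ ?_
  · rw [pderiv_egf i hd, pderiv_exponent i (hmd 1) (hld 1) (hmd 2) n hg hh,
      MvPowerSeries.smul_eq_C_mul]
    simp only [X_mul_egf]
    simp only [sub_eq_add_neg, ← egf_mul_left, ← egf_add, ← egf_neg]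
    congr 1
    funext t
    have h1 := neg_one_pow_mul_pred (fun t => typeSum lam mu n t 1) t
    have h2 := neg_one_pow_mul_pred (fun t => typeSum lam mu n t 0) t
    have h3 := neg_one_pow_mul_choose_two (fun t => typeSum lam mu n t 2) t
    have h4 := typeSum_succ_left hls hms hl0 hm0 n t
    rw [pow_succ]
    simp only [← sub_eq_add_neg]
    linear_combination (-(-1) ^ t) * h4 - (mu 1 + n * mu 1 ^ 2) * h1 - mu 2 * h2 - mu 1 ^ 2 * h3
  · rw [Derivation.leibniz, pderiv_expS hΦ0, ← typeSum_zero_zero hl hm, hd0]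
    simp only [smul_eq_mul]
    ring
  · have h1 := X_dvd_egf_sub i (fun t => (-1) ^ t * typeSum lam mu n t 0)
    have h2 := (hdvd.trans (dvd_expS_sub_one hΦ0)).mul_left (typeSum lam mu n 0 0)
    rw [pow_zero, one_mul] at h1
    rw [← typeSum_zero_zero hl hm]
    convert dvd_sub h1 h2 using 1
    ring

/-- The multigraphs of minimum degree at least three in terms of all multigraphs. -/
theorem hasSum_allSum_three_le (hl : HasSum lam L) (hm : HasSum mu Y) (hl0 : lam 0 = 1)
    (hm0 : mu 0 = 1) (hld : ∀ k, MvPowerSeries.pderiv ℚ i (lam k) = 0)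
    (hmd : ∀ k, MvPowerSeries.pderiv ℚ i (mu k) = 0) :
    HasSum (fun n : ℕ => (1 / n.factorial : ℚ) •
        ((MvPowerSeries.X i * (L * expS (vertexExponent (MvPowerSeries.X i) (mu 1) (mu 2)))) ^ n *
          (Y * expS (chainSeries (MvPowerSeries.X i) (mu 1))) ^ n.choose 2))
      (expS (-closedExponent (MvPowerSeries.X i) (mu 1) (lam 1) (mu 2)) *
        egf i fun n => allSum lam mu (fun d => 3 ≤ d) (Fin n)) := by
  -- The outer index counts unbounded vertices, the inner one those forced to have small degree.
  have h1 := hasSum_egf_egf i fun n t => (-1) ^ t * typeSum lam mu n t 0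
  simp only [egf_typeSum hl hm hl0 hm0 hld hmd, ← allSum_three_le hl.summable hm.summable] at h1
  refine (h1.mul_left
    (expS (-closedExponent (MvPowerSeries.X i) (mu 1) (lam 1) (mu 2)))).congr_fun fun n => ?_
  have hX : MvPowerSeries.constantCoeff (MvPowerSeries.X i : MvPowerSeries σ ℚ) = 0 := by simp
  have c1 := constantCoeff_eq_zero_of_dvd hX (dvd_closedExponent hX (mu 1) (lam 1) (mu 2))
  have c2 := constantCoeff_eq_zero_of_dvd hX (dvd_vertexExponent _ (mu 1) (mu 2))
  have c3 := constantCoeff_eq_zero_of_dvd hX (dvd_chainSeries _ (mu 1))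
  rw [expS_add (by simp [c1, c2]) (by simp [c3]), expS_add c1 (by simp [c2]), expS_nsmul c2,
    expS_nsmul c3, mul_smul_comm]
  congr 1
  simp only [mul_pow]
  linear_combination (-(MvPowerSeries.X i ^ n * (L ^ n * expS (vertexExponent (MvPowerSeries.X i)
    (mu 1) (mu 2)) ^ n) * (Y ^ n.choose 2 *
      expS (chainSeries (MvPowerSeries.X i) (mu 1)) ^ n.choose 2))) * expS_mul_expS_neg c1

end

end Multigraph

open Multigraph

/-! ### The multigraph series -/

section

/-- The weight of `k` loops. -/
noncomputable def loopWeight (k : ℕ) : MvPowerSeries Var ℚ :=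
  (1 / (2 ^ k * k.factorial) : ℚ) • varZ ^ k

/-- The weight of a `k`-edge. -/
noncomputable def multiWeight (k : ℕ) : MvPowerSeries Var ℚ :=
  (1 / k.factorial : ℚ) • varY k

theorem loopWeight_zero : loopWeight 0 = 1 := by simp [loopWeight]

theorem loopWeight_one : loopWeight 1 = (1 / 2 : ℚ) • varZ := by simp [loopWeight]

theorem multiWeight_zero : multiWeight 0 = 1 := by simp [multiWeight, varY]

theorem multiWeight_one : multiWeight 1 = varY 1 := by simp [multiWeight]

theorem multiWeight_two : multiWeight 2 = (1 / 2 : ℚ) • varY 2 := by simp [multiWeight]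

theorem pderiv_varY (k : ℕ) : MvPowerSeries.pderiv ℚ Var.x (varY k) = 0 := by
  rcases k with _ | k
  · exact MvPowerSeries.pderiv_one
  · exact MvPowerSeries.pderiv_X_of_ne (by simp)

theorem pderiv_loopWeight (k : ℕ) : MvPowerSeries.pderiv ℚ Var.x (loopWeight k) = 0 := by
  rw [loopWeight, Derivation.map_smul, Derivation.leibniz_pow, varZ,
    MvPowerSeries.pderiv_X_of_ne (by simp)]
  simp

theorem pderiv_multiWeight (k : ℕ) : MvPowerSeries.pderiv ℚ Var.x (multiWeight k) = 0 := by
  rw [multiWeight, Derivation.map_smul, pderiv_varY, smul_zero]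

theorem hasSum_loopWeight : HasSum loopWeight (expS ((1 / 2 : ℚ) • varZ)) := by
  refine (hasSum_expS (by simp [varZ, MvPowerSeries.smul_eq_C_mul])).congr_fun fun k => ?_
  rw [loopWeight, smul_pow, smul_smul]
  congr 1
  simp [mul_comm]

/-- The `y_k` are distinct variables, so apart from `k = 0` each monomial occurs in at most one
term. -/
theorem summable_multiWeight : Summable multiWeight := by
  refine summable_of_finite_coeff fun d => ?_
  have h : {k : ℕ | Finsupp.single (Var.y k.succPNat) 1 = d}.Subsingleton := by
    intro a ha b hb
    have h1 : (Finsupp.single (Var.y a.succPNat) 1 : Var →₀ ℕ) =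
      Finsupp.single (Var.y b.succPNat) 1 := ha.trans hb.symm
    have h2 := (Finsupp.single_eq_single_iff _ _ _ _).1 h1
    simpa using h2
  refine ((h.finite.image Nat.succ).union (Set.finite_singleton 0)).subset fun k hk => ?_
  rcases k with _ | k
  · exact Or.inr rfl
  · refine Or.inl ⟨k, ?_, rfl⟩
    classical
    by_contra hne
    refine hk ?_
    simp only [multiWeight, varY, map_smul, MvPowerSeries.coeff_X]
    rw [if_neg fun h => hne h.symm, smul_zero]

/-- The monomial in the variables `y i` of a multiplicity. -/
noncomputable def edgeExponent : ℕ → Var →₀ ℕ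
  | 0 => 0
  | k + 1 => Finsupp.single (Var.y k.succPNat) 1

theorem varY_eq_monomial (k : ℕ) : varY k = MvPowerSeries.monomial (edgeExponent k) 1 := by
  rcases k with _ | k
  · rfl
  · rfl

theorem edgeExponent_x (k : ℕ) : edgeExponent k Var.x = 0 := by
  rcases k with _ | k <;> simp [edgeExponent]

theorem edgeExponent_z (k : ℕ) : edgeExponent k Var.z = 0 := by
  rcases k with _ | k <;> simp [edgeExponent]

theorem edgeExponent_y (k : ℕ) (i : ℕ+) :
    edgeExponent k (Var.y i) = if k = (i : ℕ) then 1 else 0 := by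
  classical
  rcases k with _ | k
  · simp [edgeExponent, i.pos.ne]
  · simp only [edgeExponent, Finsupp.single_apply, Var.y.injEq]
    refine if_congr ?_ rfl rfl
    rw [← PNat.coe_inj]
    simp

/-- The monomial of a multigraph in the variables `z` and `y i`. -/
noncomputable def graphExponent {V : Type} [Fintype V] [DecidableEq V] (G : Multigraph V) :
    Var →₀ ℕ :=
  Finsupp.single Var.z G.numLoops + ∑ e : Sym2 V with ¬ e.IsDiag, edgeExponent (G e)

theorem prod_sym2_isDiag {V M : Type} [Fintype V] [DecidableEq V] [CommMonoid M]
    (f : Sym2 V → M) : ∏ e : Sym2 V with e.IsDiag, f e = ∏ v, f s(v, v) := by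
  symm
  refine Finset.prod_bij (fun v _ => s(v, v)) (by simp) ?_ ?_ (by simp)
  · intro a _ b _ h
    simpa using h
  · intro e he
    induction e with | _ a b
    obtain rfl : a = b := by simpa using he
    exact ⟨a, by simp, rfl⟩

/-- With `loopWeight` and `multiWeight`, one product over pairs records both the rational weight and
the exponents of `z` and the `y_i`. -/
theorem omega_eq_monomial {V : Type} [Fintype V] [DecidableEq V] (G : Multigraph V) :
    omega loopWeight multiWeight G = MvPowerSeries.monomial (graphExponent G) G.weight := by
  have h1 : ∀ k, loopWeight k = MvPowerSeries.monomial (Finsupp.single Var.z k)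
      (1 / ((2 : ℚ) ^ k * (k.factorial : ℚ))) := fun k => by
    rw [loopWeight, varZ, MvPowerSeries.X_pow_eq, ← map_smul, smul_eq_mul, mul_one]
  have h2 : ∀ k, multiWeight k = MvPowerSeries.monomial (edgeExponent k)
      (1 / (k.factorial : ℚ)) := fun k => by
    rw [multiWeight, varY_eq_monomial, ← map_smul, smul_eq_mul, mul_one]
  have h3 : ∀ (ι : Type) (s : Finset ι) (e : ι → Var →₀ ℕ) (c : ι → ℚ),
      ∏ j ∈ s, MvPowerSeries.monomial (e j) (c j) =
        MvPowerSeries.monomial (∑ j ∈ s, e j) (∏ j ∈ s, c j) := fun ι s e c => by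
    classical
    induction s using Finset.induction_on with
    | empty => rfl
    | insert a s ha ih =>
      rw [Finset.prod_insert ha, Finset.sum_insert ha, Finset.prod_insert ha, ih,
        MvPowerSeries.monomial_mul_monomial]
  rw [omega, ← Finset.prod_filter_mul_prod_filter_not Finset.univ Sym2.IsDiag,
    prod_sym2_isDiag, graphExponent, weight, numLoops]
  have h4 : ∀ v, edgeWeight loopWeight multiWeight s(v, v) (G s(v, v)) =
      loopWeight (G s(v, v)) := fun v => by simp [edgeWeight]
  have h5 : ∀ e ∈ Finset.univ.filter fun e : Sym2 V => ¬ e.IsDiag,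
      edgeWeight loopWeight multiWeight e (G e) = multiWeight (G e) := fun e he => by
    rw [edgeWeight, if_neg (Finset.mem_filter.1 he).2]
  rw [Finset.prod_congr rfl h5]
  simp only [h4, h1, h2, h3, MvPowerSeries.monomial_mul_monomial]
  rw [Finsupp.single_finsetSum]

theorem single_add_graphExponent_eq_iff {V : Type} [Fintype V] [DecidableEq V]
    (G : Multigraph V) (n : ℕ) (d : Var →₀ ℕ) :
    d = Finsupp.single Var.x n + graphExponent G ↔
      n = d Var.x ∧ G.numLoops = d Var.z ∧ ∀ i : ℕ+, G.numEdges i = d (Var.y i) := by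
  have hx : (Finsupp.single Var.x n + graphExponent G) Var.x = n := by
    simp [graphExponent, edgeExponent_x]
  have hz : (Finsupp.single Var.x n + graphExponent G) Var.z = G.numLoops := by
    simp [graphExponent, edgeExponent_z]
  have hy : ∀ i : ℕ+, (Finsupp.single Var.x n + graphExponent G) (Var.y i) = G.numEdges i :=
    fun i => by
      simp [graphExponent, edgeExponent_y, numEdges, Finset.filter_filter]
  constructor
  · intro h
    rw [h]
    exact ⟨hx.symm, hz.symm, fun i => (hy i).symm⟩
  · rintro ⟨h1, h2, h3⟩
    ext v
    rcases v with _ | _ | i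
    · rw [hx, h1]
    · rw [hz, h2]
    · rw [hy, h3]

/-- Bridges the coefficientwise definition and the analytic one: `x ^ n * omega G / n!` is a single
monomial, so a fixed coefficient selects `n = d x` and the finitely many graphs with the prescribed
counts. -/
theorem multiGF_eq_egf (k : ℕ) : multiGF k =
    egf Var.x fun n => connSum loopWeight multiWeight (fun d => k ≤ d) (Fin n) := by
  classical
  ext d
  have h0 : ∀ n, HasSum (fun G : Multigraph (Fin n) => MvPowerSeries.coeff d
      ((1 / n.factorial : ℚ) • (MvPowerSeries.X Var.x ^ n * if G.IsKMultigraph k then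
        omega loopWeight multiWeight G else 0)))
      (MvPowerSeries.coeff d ((1 / n.factorial : ℚ) • (MvPowerSeries.X Var.x ^ n *
        connSum loopWeight multiWeight (fun d => k ≤ d) (Fin n)))) := fun n => by
    refine MvPowerSeries.WithPiTopology.hasSum_iff_hasSum_coeff.1 ?_ d
    exact ((summable_omega_ite hasSum_loopWeight.summable summable_multiWeight
      fun G : Multigraph (Fin n) => G.IsKMultigraph k).hasSum.mul_left _).const_smul _
  have h1 : ∀ n (G : Multigraph (Fin n)), MvPowerSeries.coeff d
      ((1 / n.factorial : ℚ) • (MvPowerSeries.X Var.x ^ n * if G.IsKMultigraph k then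
        omega loopWeight multiWeight G else 0)) =
      if G.IsKMultigraph k ∧ n = d Var.x ∧ G.numLoops = d Var.z ∧
        ∀ i : ℕ+, G.numEdges i = d (Var.y i) then G.weight / n.factorial else 0 := fun n G => by
    simp only [← single_add_graphExponent_eq_iff]
    rw [omega_eq_monomial, map_smul, MvPowerSeries.X_pow_eq, ite_and]
    by_cases h : G.IsKMultigraph k
    · rw [if_pos h, if_pos h, MvPowerSeries.monomial_mul_monomial, MvPowerSeries.coeff_monomial]
      split_ifs <;> simp [div_eq_inv_mul]
    · rw [if_neg h, if_neg h, mul_zero, map_zero, smul_zero]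
  have h2 := MvPowerSeries.WithPiTopology.hasSum_iff_hasSum_coeff.1 (hasSum_egf Var.x fun n =>
    connSum loopWeight multiWeight (fun d => k ≤ d) (Fin n)) d
  refine HasSum.unique ?_ h2
  have h3 : MvPowerSeries.coeff d ((1 / (d Var.x).factorial : ℚ) •
      (MvPowerSeries.X Var.x ^ (d Var.x) *
        connSum loopWeight multiWeight (fun d => k ≤ d) (Fin (d Var.x)))) =
      MvPowerSeries.coeff d (multiGF k) := by
    refine (h0 (d Var.x)).unique ?_
    have h4 : MvPowerSeries.coeff d (multiGF k) =
        ∑ G ∈ (finite_multigraphsWith k d).toFinset, G.weight / (d Var.x).factorial := by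
      rw [← Finset.sum_div]
      rfl
    rw [h4]
    have h5 : ∀ G : Multigraph (Fin (d Var.x)), (G.IsKMultigraph k ∧ d Var.x = d Var.x ∧
        G.numLoops = d Var.z ∧ ∀ i : ℕ+, G.numEdges i = d (Var.y i)) ↔
        G ∈ (finite_multigraphsWith k d).toFinset := fun G => by
      rw [Set.Finite.mem_toFinset]
      simp [multigraphsWith]
    rw [← Finset.sum_congr rfl fun G hG => (h1 _ G).trans (if_pos ((h5 G).2 hG))]
    exact hasSum_sum_of_ne_finset_zero fun G hG =>
      (h1 _ G).trans (if_neg fun h => hG ((h5 G).1 h))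
  rw [← h3]
  refine hasSum_single _ fun n hn => ?_
  refine (h0 n).unique ?_
  simp only [h1]
  refine hasSum_zero.congr_fun fun G => if_neg fun h => hn h.2.1

end

/-! ### Substitution -/

section Subst

variable {σ τ : Type} {a : σ → MvPowerSeries τ ℚ} {f : MvPowerSeries σ ℚ}

theorem subst_powerSeries_subst (ha : MvPowerSeries.HasSubst a)
    (hf : MvPowerSeries.constantCoeff f = 0) (P : PowerSeries ℚ) :
    MvPowerSeries.subst a (PowerSeries.subst f P) =
      PowerSeries.subst (MvPowerSeries.subst a f) P :=
  MvPowerSeries.subst_comp_subst_apply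
    (PowerSeries.HasSubst.const (PowerSeries.HasSubst.of_constantCoeff_zero hf)) ha P

theorem subst_expS (ha : MvPowerSeries.HasSubst a) (hf : MvPowerSeries.constantCoeff f = 0) :
    MvPowerSeries.subst a (expS f) = expS (MvPowerSeries.subst a f) :=
  subst_powerSeries_subst ha hf _

theorem subst_logOneAdd (ha : MvPowerSeries.HasSubst a)
    (hf : MvPowerSeries.constantCoeff f = 0) :
    MvPowerSeries.subst a (logOneAdd f) = logOneAdd (MvPowerSeries.subst a f) :=
  subst_powerSeries_subst ha hf _

theorem subst_one (ha : MvPowerSeries.HasSubst a) :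
    MvPowerSeries.subst a (1 : MvPowerSeries σ ℚ) = 1 := by
  rw [← MvPowerSeries.coe_substAlgHom ha, map_one]

theorem subst_inv (ha : MvPowerSeries.HasSubst a) (hf : MvPowerSeries.constantCoeff f ≠ 0) :
    MvPowerSeries.subst a f⁻¹ = (MvPowerSeries.subst a f)⁻¹ := by
  have h : MvPowerSeries.subst a f⁻¹ * MvPowerSeries.subst a f = 1 := by
    rw [← MvPowerSeries.subst_mul ha, MvPowerSeries.inv_mul_cancel _ hf, subst_one ha]
  refine (MvPowerSeries.eq_inv_iff_mul_eq_one fun h0 => ?_).2 h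
  have h2 := congrArg MvPowerSeries.constantCoeff h
  rw [map_mul, h0, mul_zero, map_one] at h2
  exact zero_ne_one h2

theorem hasSum_mvSubst {ι : Type} {F : ι → MvPowerSeries σ ℚ} (ha : MvPowerSeries.HasSubst a)
    (h : HasSum F f) : HasSum (fun j => MvPowerSeries.subst a (F j)) (MvPowerSeries.subst a f) := by
  rw [← MvPowerSeries.coe_substAlgHom ha]
  refine h.map (MvPowerSeries.substAlgHom ha) ?_
  rw [MvPowerSeries.coe_substAlgHom ha]
  exact MvPowerSeries.continuous_subst ha

end Subst

/-! ### The exponentials of both multigraph series as sums over the number of vertices -/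

theorem hasSum_expS_connectedMultiGF {Y : MvPowerSeries Var ℚ} (hY : HasSum multiWeight Y) :
    MvPowerSeries.constantCoeff connectedMultiGF = 0 ∧
    HasSum (fun n : ℕ => (1 / n.factorial : ℚ) •
      ((varX * expS ((1 / 2 : ℚ) • varZ)) ^ n * Y ^ n.choose 2)) (expS connectedMultiGF) := by
  have h := expS_egf_connSum hasSum_loopWeight.summable summable_multiWeight multiWeight_zero
    pderiv_loopWeight pderiv_multiWeight (fun d => 0 ≤ d)
  rw [← multiGF_eq_egf] at h
  refine ⟨h.1, ?_⟩
  rw [connectedMultiGF, h.2]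
  refine (hasSum_egf _ _).congr_fun fun n => ?_
  rw [allSum, wsum_true hasSum_loopWeight hY fun G v => Nat.zero_le _, Fintype.card_fin, mul_pow,
    mul_assoc]
  rfl

/-- A substitution affects the exponential only through `a x * exp (a z / 2)` and the transformed
sum `Y`; later comparisons need to match only these two quantities. -/
theorem hasSum_expS_subst {τ : Type} {a : Var → MvPowerSeries τ ℚ}
    (ha : MvPowerSeries.HasSubst a) (ha0 : ∀ v, MvPowerSeries.constantCoeff (a v) = 0)
    {Y : MvPowerSeries τ ℚ}
    (hY : HasSum (fun k => MvPowerSeries.subst a (multiWeight k)) Y) :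
    MvPowerSeries.constantCoeff (MvPowerSeries.subst a connectedMultiGF) = 0 ∧
    HasSum (fun n : ℕ => (1 / n.factorial : ℚ) •
      ((a Var.x * expS ((1 / 2 : ℚ) • a Var.z)) ^ n * Y ^ n.choose 2))
      (expS (MvPowerSeries.subst a connectedMultiGF)) := by
  obtain ⟨h0, h⟩ := hasSum_expS_connectedMultiGF summable_multiWeight.hasSum
  have hz : MvPowerSeries.constantCoeff ((1 / 2 : ℚ) • varZ) = 0 := by
    simp [varZ, MvPowerSeries.smul_eq_C_mul]
  refine ⟨MvPowerSeries.constantCoeff_subst_eq_zero ha ha0 h0, ?_⟩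
  rw [← subst_expS ha h0]
  refine (hasSum_mvSubst ha h).congr_fun fun n => ?_
  rw [MvPowerSeries.subst_smul ha, MvPowerSeries.subst_mul ha, MvPowerSeries.subst_pow ha,
    MvPowerSeries.subst_pow ha, MvPowerSeries.subst_mul ha, subst_expS ha hz,
    MvPowerSeries.subst_smul ha, varX, varZ, MvPowerSeries.subst_X ha, MvPowerSeries.subst_X ha,
    (hasSum_mvSubst ha summable_multiWeight.hasSum).unique hY]

theorem constantCoeff_varX : MvPowerSeries.constantCoeff varX = 0 :=
  MvPowerSeries.constantCoeff_X _

theorem hasSum_expS_threeMultiGF {Y : MvPowerSeries Var ℚ} (hY : HasSum multiWeight Y) :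
    MvPowerSeries.constantCoeff threeMultiGF = 0 ∧
    HasSum (fun n : ℕ => (1 / n.factorial : ℚ) •
      ((varX * (expS ((1 / 2 : ℚ) • varZ) *
          expS (vertexExponent varX (varY 1) ((1 / 2 : ℚ) • varY 2)))) ^ n *
        (Y * expS serS) ^ n.choose 2))
      (expS (threeMultiGF -
        closedExponent varX (varY 1) ((1 / 2 : ℚ) • varZ) ((1 / 2 : ℚ) • varY 2))) := by
  have h := expS_egf_connSum hasSum_loopWeight.summable summable_multiWeight multiWeight_zero
    pderiv_loopWeight pderiv_multiWeight (fun d => 3 ≤ d)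
  rw [← multiGF_eq_egf] at h
  refine ⟨h.1, ?_⟩
  have hc : MvPowerSeries.constantCoeff (-closedExponent varX (varY 1) ((1 / 2 : ℚ) • varZ)
      ((1 / 2 : ℚ) • varY 2)) = 0 := by
    rw [map_neg, constantCoeff_eq_zero_of_dvd constantCoeff_varX
      (dvd_closedExponent constantCoeff_varX _ _ _), neg_zero]
  rw [threeMultiGF, sub_eq_neg_add, expS_add hc h.1, h.2]
  have h3 := hasSum_allSum_three_le hasSum_loopWeight hY loopWeight_zero multiWeight_zero
    pderiv_loopWeight pderiv_multiWeight
  rw [loopWeight_one, multiWeight_one, multiWeight_two] at h3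
  exact h3

/-! ### The identity for multigraphs -/

theorem serS_eq_chainSeries : serS = chainSeries varX (varY 1) := rfl

theorem constantCoeff_serS : MvPowerSeries.constantCoeff serS = 0 :=
  constantCoeff_eq_zero_of_dvd constantCoeff_varX (dvd_chainSeries _ _)

/-- The sum `∑_{j ≤ k} (k choose j) y_j s ^ (k - j)`. -/
noncomputable def shiftedY (k : ℕ) : MvPowerSeries Var ℚ :=
  ∑ j ∈ Finset.range (k + 1), ((k.choose j : ℕ) : ℚ) • (varY j * serS ^ (k - j))

/-- The Cauchy product of `∑ y_j / j!` and `∑ s ^ i / i!`, grouped by `i + j = k`. This is why the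
substitution for `y_k` is a binomial sum. -/
theorem hasSum_shiftedY {Y : MvPowerSeries Var ℚ} (hY : HasSum multiWeight Y) :
    HasSum (fun k : ℕ => (1 / k.factorial : ℚ) • shiftedY k) (Y * expS serS) := by
  have h1 := hasSum_expS constantCoeff_serS
  have h2 := hY.mul_of_nonarchimedean h1
  rw [← Finset.HasAntidiagonal.sigmaAntidiagonalEquivProd.hasSum_iff] at h2
  have h3 := h2.sigma fun k => hasSum_fintype _
  refine h3.congr_fun fun k => ?_
  rw [Finset.univ_eq_attach]
  refine Eq.trans ?_ (Finset.sum_coe_sort (Finset.HasAntidiagonal.antidiagonal k) fun p : ℕ × ℕ =>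
    multiWeight p.1 * ((1 / p.2.factorial : ℚ) • serS ^ p.2)).symm
  rw [Finset.Nat.sum_antidiagonal_eq_sum_range_succ fun j i => multiWeight j *
    ((1 / i.factorial : ℚ) • serS ^ i), shiftedY, Finset.smul_sum]
  refine Finset.sum_congr rfl fun j hj => ?_
  have hjk : j ≤ k := Nat.lt_succ_iff.1 (Finset.mem_range.1 hj)
  rw [multiWeight, smul_mul_smul_comm, smul_smul, Nat.cast_choose ℚ hjk]
  congr 1
  have : (k.factorial : ℚ) ≠ 0 := by positivity
  field_simp

theorem constantCoeff_kernelSubst (v : Var) :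
    MvPowerSeries.constantCoeff (kernelSubst v) = 0 := by
  rcases v with _ | _ | k
  · simp [kernelSubst, constantCoeff_varX]
  · simp [kernelSubst, constantCoeff_varX, varZ]
  · rw [kernelSubst, map_sum]
    refine Finset.sum_eq_zero fun j hj => ?_
    rw [MvPowerSeries.smul_eq_C_mul, map_mul, map_mul, map_pow, constantCoeff_serS]
    rcases j with _ | j
    · simp
    · simp [varY]

/-- There are infinitely many variables, so vanishing constant terms do not suffice: each
coefficient may be met by only finitely many images. Summability in `hasSum_shiftedY` supplies this.
-/
theorem hasSubst_kernelSubst : MvPowerSeries.HasSubst kernelSubst := by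
  refine ⟨fun v => by simp [constantCoeff_kernelSubst], fun d => ?_⟩
  have h := finite_coeff_of_summable (hasSum_shiftedY summable_multiWeight.hasSum).summable d
  have h2 : ((fun k : ℕ+ => (k : ℕ)) ⁻¹' {k : ℕ | MvPowerSeries.coeff d
      ((1 / k.factorial : ℚ) • shiftedY k) ≠ 0}).Finite :=
    h.preimage PNat.coe_injective.injOn
  refine ((h2.image Var.y).union (Set.toFinite {Var.x, Var.z})).subset fun v hv => ?_
  rcases v with _ | _ | k
  · exact Or.inr (Or.inl rfl)
  · exact Or.inr (Or.inr rfl)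
  · refine Or.inl ⟨k, ?_, rfl⟩
    have hv' : MvPowerSeries.coeff d (shiftedY k) ≠ 0 := hv
    simp [hv', Nat.factorial_ne_zero]

theorem subst_kernelSubst_multiWeight (k : ℕ) :
    MvPowerSeries.subst kernelSubst (multiWeight k) = (1 / k.factorial : ℚ) • shiftedY k := by
  rw [multiWeight, MvPowerSeries.subst_smul hasSubst_kernelSubst]
  congr 1
  rcases k with _ | k
  · simp [varY, shiftedY, subst_one hasSubst_kernelSubst]
  · rw [varY, MvPowerSeries.subst_X hasSubst_kernelSubst]
    rfl

theorem threeMultiGF_eq : threeMultiGF =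
    MvPowerSeries.subst kernelSubst connectedMultiGF + serE varX (varY 1)
      - (1 / 2 : ℚ) • (varX * varZ) + (1 / 4 : ℚ) • (varX ^ 2 * varY 2) := by
  have hY := summable_multiWeight.hasSum
  obtain ⟨h1, h2⟩ := hasSum_expS_threeMultiGF hY
  obtain ⟨h3, h4⟩ := hasSum_expS_subst hasSubst_kernelSubst constantCoeff_kernelSubst
    (Y := (∑' k, multiWeight k) * expS serS)
    ((hasSum_shiftedY hY).congr_fun fun k => subst_kernelSubst_multiWeight k)
  -- The exponents `-x (y₁ + s)` and half of `-s x y₁ - x y₂ + z` add up to `z / 2` plus the vertex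
  -- exponent.
  have h5 : kernelSubst Var.x * expS ((1 / 2 : ℚ) • kernelSubst Var.z) =
      varX * (expS ((1 / 2 : ℚ) • varZ) *
        expS (vertexExponent varX (varY 1) ((1 / 2 : ℚ) • varY 2))) := by
    have hv := constantCoeff_eq_zero_of_dvd constantCoeff_varX
      (dvd_vertexExponent varX (varY 1) ((1 / 2 : ℚ) • varY 2))
    have hz : MvPowerSeries.constantCoeff ((1 / 2 : ℚ) • varZ) = 0 := by
      simp [varZ, MvPowerSeries.smul_eq_C_mul]
    have hk : MvPowerSeries.constantCoeff ((1 / 2 : ℚ) • kernelSubst Var.z) = 0 := by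
      simp [MvPowerSeries.smul_eq_C_mul, constantCoeff_kernelSubst]
    have hx : MvPowerSeries.constantCoeff (-varX * (varY 1 + serS)) = 0 := by
      simp [constantCoeff_varX]
    rw [← expS_add hz hv, kernelSubst, mul_assoc, ← expS_add hx hk]
    congr 2
    rw [vertexExponent, kernelSubst, ← serS_eq_chainSeries]
    simp only [MvPowerSeries.smul_eq_C_mul]
    ring
  rw [h5] at h4
  have hc := constantCoeff_eq_zero_of_dvd constantCoeff_varX (dvd_closedExponent
    constantCoeff_varX (varY 1) ((1 / 2 : ℚ) • varZ) ((1 / 2 : ℚ) • varY 2))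
  have h6 := expS_injective (by rw [map_sub, h1, hc, sub_zero]) h3 (h2.unique h4)
  rw [sub_eq_iff_eq_add] at h6
  rw [h6, closedExponent]
  have hq : (MvPowerSeries.C (1 / 2 : ℚ) : MvPowerSeries Var ℚ) * MvPowerSeries.C (1 / 2 : ℚ) =
      MvPowerSeries.C (1 / 4 : ℚ) := by
    rw [← map_mul]
    norm_num
  simp only [MvPowerSeries.smul_eq_C_mul, ← hq]
  ring

/-! ### Simple graphs as multigraphs -/

namespace Multigraph

section

variable {V : Type}

open Classical in
/-- A simple graph as a multigraph. -/
noncomputable def ofSimple (G : SimpleGraph V) : Multigraph V := fun e =>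
  if e ∈ G.edgeSet then 1 else 0

theorem ofSimple_diag (G : SimpleGraph V) (v : V) : ofSimple G s(v, v) = 0 := by
  simp [ofSimple]

theorem toSimple_ofSimple (G : SimpleGraph V) : (ofSimple G).toSimple = G := by
  ext u v
  simp only [toSimple, ofSimple, SimpleGraph.mem_edgeSet]
  by_cases h : G.Adj u v
  · simp [h, h.ne]
  · simp [h]

theorem ofSimple_injective : Function.Injective (ofSimple : SimpleGraph V → Multigraph V) :=
  Function.LeftInverse.injective toSimple_ofSimple

theorem ofSimple_toSimple {G : Multigraph V} (h0 : ∀ v, G s(v, v) = 0) (h1 : ∀ e, G e ≤ 1) :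
    ofSimple G.toSimple = G := by
  ext e
  induction e with | _ u v
  simp only [toSimple, ofSimple, SimpleGraph.mem_edgeSet]
  have h2 := h1 s(u, v)
  by_cases huv : u = v
  · subst huv
    simp [h0]
  · by_cases h : G s(u, v) = 0
    · simp [h]
    · exact (if_pos ⟨huv, h⟩).trans (by omega)

theorem numLoops_ofSimple [Fintype V] (G : SimpleGraph V) : (ofSimple G).numLoops = 0 := by
  simp [numLoops, ofSimple_diag]

theorem numEdges_ofSimple_one [Fintype V] [DecidableEq V] (G : SimpleGraph V) :
    (ofSimple G).numEdges 1 = G.edgeSet.ncard := by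
  rw [numEdges, ← Set.ncard_coe_finset]
  congr 1
  ext e
  rw [Finset.mem_coe, Finset.mem_filter, and_iff_right (Finset.mem_univ e), ofSimple]
  exact ⟨fun h => by_contra fun h2 => zero_ne_one ((if_neg h2).symm.trans h.2),
    fun h => ⟨G.not_isDiag_of_mem_edgeSet h, if_pos h⟩⟩

theorem numEdges_ofSimple [Fintype V] [DecidableEq V] {G : SimpleGraph V} {i : ℕ} (hi : 1 < i) :
    (ofSimple G).numEdges i = 0 := by
  rw [numEdges, Finset.card_eq_zero, Finset.filter_eq_empty_iff]
  rintro e - ⟨-, h⟩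
  rw [ofSimple] at h
  split_ifs at h <;> omega

theorem degree_ofSimple [Fintype V] (G : SimpleGraph V) (v : V) :
    (ofSimple G).degree v = (G.neighborSet v).ncard := by
  classical
  rw [degree, ofSimple_diag, add_zero]
  simp only [ofSimple, SimpleGraph.mem_edgeSet]
  rw [Finset.sum_boole, Nat.cast_id, ← Set.ncard_coe_finset]
  congr 1
  ext u
  simp

theorem weight_ofSimple [Fintype V] [DecidableEq V] (G : SimpleGraph V) :
    (ofSimple G).weight = 1 := by
  have h : ∀ e, ((ofSimple G e).factorial : ℚ) = 1 := fun e => by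
    rw [ofSimple]
    split_ifs <;> simp
  simp [weight, h, ofSimple_diag]

end

end Multigraph

/-- No loops and no `i`-edges for `i ≥ 2` leave only multiplicities zero and one. -/
theorem multigraphsWith_eq_image (k : ℕ) {d : Var →₀ ℕ} (hz : d Var.z = 0)
    (hy : ∀ i : ℕ+, i ≠ 1 → d (Var.y i) = 0) :
    multigraphsWith k d = ofSimple '' {G : SimpleGraph (Fin (d Var.x)) |
      G.Connected ∧ (∀ v, k ≤ (G.neighborSet v).ncard) ∧ G.edgeSet.ncard = d (Var.y 1)} := by
  have key : ∀ G : SimpleGraph (Fin (d Var.x)), ofSimple G ∈ multigraphsWith k d ↔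
      G.Connected ∧ (∀ v, k ≤ (G.neighborSet v).ncard) ∧ G.edgeSet.ncard = d (Var.y 1) := by
    intro G
    rw [multigraphsWith, Set.mem_ofPred_eq, IsKMultigraph, toSimple_ofSimple, numLoops_ofSimple, hz]
    simp only [degree_ofSimple, true_and, and_assoc]
    refine and_congr_right fun _ => and_congr_right fun _ => ⟨fun h => ?_, fun h i => ?_⟩
    · rw [← h 1, PNat.one_coe, numEdges_ofSimple_one]
    · by_cases hi : i = 1
      · rw [hi, PNat.one_coe, numEdges_ofSimple_one, h]
      · rw [hy i hi, numEdges_ofSimple]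
        exact lt_of_le_of_ne i.pos fun h => hi (PNat.coe_injective h.symm)
  ext G
  constructor
  · intro hG
    have hl : ∀ v, G s(v, v) = 0 := fun v =>
      Finset.sum_eq_zero_iff.1 (hG.2.1.trans hz) v (Finset.mem_univ v)
    have h1 : ∀ e, G e ≤ 1 := by
      intro e
      by_contra! h
      have hd : ¬ e.IsDiag := fun hd => by
        induction e with | _ u v
        obtain rfl : u = v := hd
        rw [hl] at h
        omega
      have h2 := (hG.2.2 ⟨G e, by omega⟩).trans (hy _ fun h3 => by
        have := congrArg PNat.val h3
        simp only [PNat.mk_coe, PNat.val_ofNat] at this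
        omega)
      rw [numEdges, Finset.card_eq_zero, Finset.filter_eq_empty_iff] at h2
      exact h2 (Finset.mem_univ e) ⟨hd, rfl⟩
    have h2 := ofSimple_toSimple hl h1
    exact ⟨G.toSimple, (key _).1 (by rwa [h2]), h2⟩
  · rintro ⟨G, hG, rfl⟩
    exact (key G).2 hG

theorem coeff_multiGF (k n m : ℕ) {d : Var →₀ ℕ} (hx : d Var.x = n) (hz : d Var.z = 0)
    (hm : d (Var.y 1) = m) (hy : ∀ i : ℕ+, i ≠ 1 → d (Var.y i) = 0) :
    MvPowerSeries.coeff d (multiGF k) = (Nat.card {G : SimpleGraph (Fin n) //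
      G.Connected ∧ (∀ v, k ≤ (G.neighborSet v).ncard) ∧ G.edgeSet.ncard = m} : ℚ)
      / (n.factorial : ℚ) := by
  subst hx hm
  change (∑ G ∈ (finite_multigraphsWith k d).toFinset, G.weight) / _ = _
  congr 1
  have h : ∀ G ∈ (finite_multigraphsWith k d).toFinset, G.weight = 1 := fun G hG => by
    rw [Set.Finite.mem_toFinset, multigraphsWith_eq_image k hz hy] at hG
    obtain ⟨G, -, rfl⟩ := hG
    exact weight_ofSimple G
  rw [Finset.sum_congr rfl h, Finset.sum_const, nsmul_one,
    ← Set.ncard_eq_toFinset_card _ (finite_multigraphsWith k d),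
    multigraphsWith_eq_image k hz hy, Set.ncard_image_of_injective _ ofSimple_injective]
  rfl

/-- The substitution `x ↦ x`, `z ↦ 0`, `y_1 ↦ y`, `y_k ↦ 0` for `k ≥ 2`. -/
noncomputable def simpleProj : Var → MvPowerSeries (Fin 2) ℚ
  | Var.x => MvPowerSeries.X 0
  | Var.z => 0
  | Var.y k => if k = 1 then MvPowerSeries.X 1 else 0

theorem constantCoeff_simpleProj (v : Var) :
    MvPowerSeries.constantCoeff (simpleProj v) = 0 := by
  rcases v with _ | _ | k
  · exact MvPowerSeries.constantCoeff_X _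
  · exact map_zero _
  · rw [simpleProj]
    split_ifs
    · exact MvPowerSeries.constantCoeff_X _
    · exact map_zero _

theorem hasSubst_simpleProj : MvPowerSeries.HasSubst simpleProj := by
  refine ⟨fun v => by simp [constantCoeff_simpleProj], fun d => ?_⟩
  refine (Set.toFinite {Var.x, Var.z, Var.y 1}).subset fun v hv => ?_
  rcases v with _ | _ | k
  · exact Or.inl rfl
  · exact Or.inr (Or.inl rfl)
  · refine Or.inr (Or.inr ?_)
    by_contra hk
    refine hv ?_
    rw [simpleProj, if_neg fun h => hk (by rw [h]; rfl), map_zero]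

theorem subst_simpleProj_multiGF (k : ℕ) :
    MvPowerSeries.subst simpleProj (multiGF k) = simpleGF k := by
  classical
  ext d
  let e0 : Var →₀ ℕ := Finsupp.single Var.x (d 0) + Finsupp.single (Var.y 1) (d 1)
  -- A monomial survives the projection only if it involves just `x` and `y₁`, so each target
  -- coefficient comes from the single exponent `e0`.
  have hprod : ∀ e : Var →₀ ℕ, MvPowerSeries.coeff d (e.prod fun s n => simpleProj s ^ n) =
      if e = e0 then 1 else 0 := by
    intro e
    by_cases h : ∀ v, v ≠ Var.x → v ≠ Var.y 1 → e v = 0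
    · have he : e = Finsupp.single Var.x (e Var.x) + Finsupp.single (Var.y 1) (e (Var.y 1)) := by
        ext v
        by_cases hx : v = Var.x
        · simp [hx]
        · by_cases hy : v = Var.y 1
          · simp [hy]
          · rw [h v hx hy]
            simp [Ne.symm hx, Ne.symm hy]
      have h1 : (e = e0) = (d = Finsupp.single 0 (e Var.x) + Finsupp.single 1 (e (Var.y 1))) := by
        refine propext ⟨fun h => ?_, fun h => ?_⟩
        · ext i
          fin_cases i <;> simp [h, e0]
        · rw [he]
          simp only [e0]
          rw [h]
          simp
      have h2 : (e.prod fun s n => simpleProj s ^ n) =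
          MvPowerSeries.X 0 ^ e Var.x * MvPowerSeries.X 1 ^ e (Var.y 1) := by
        conv_lhs => rw [he]
        rw [Finsupp.prod_add_index' (fun _ => pow_zero _) fun _ _ _ => pow_add _ _ _]
        exact congrArg₂ (· * ·)
          (Finsupp.prod_single_index (h := fun s n => simpleProj s ^ n) (pow_zero _))
          (Finsupp.prod_single_index (h := fun s n => simpleProj s ^ n) (pow_zero _))
      simp only [h1]
      rw [h2, MvPowerSeries.X_pow_eq, MvPowerSeries.X_pow_eq, MvPowerSeries.monomial_mul_monomial,
        MvPowerSeries.coeff_monomial, one_mul]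
    · push Not at h
      obtain ⟨v, hx, hy, hv⟩ := h
      have h0 : simpleProj v = 0 := by
        rcases v with _ | _ | k
        · exact absurd rfl hx
        · rfl
        · exact if_neg fun h => hy (by rw [h])
      rw [Finsupp.prod, Finset.prod_eq_zero (Finsupp.mem_support_iff.2 hv), map_zero, if_neg]
      · rintro rfl
        refine hv ?_
        simp [e0, Ne.symm hx, Ne.symm hy]
      · rw [h0, zero_pow hv]
  rw [MvPowerSeries.coeff_subst hasSubst_simpleProj, finsum_eq_single _ e0]
  · rw [hprod, if_pos rfl, smul_eq_mul, mul_one]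
    exact coeff_multiGF k _ _ (by simp [e0]) (by simp [e0]) (by simp [e0]) fun i hi => by
      simp [e0, Ne.symm hi]
  · intro e he
    rw [hprod, if_neg he, smul_zero]

/-! ### The identity for simple graphs -/

section

variable {σ τ : Type} {a : σ → MvPowerSeries τ ℚ} {x y : MvPowerSeries σ ℚ}

theorem subst_chainSeries (ha : MvPowerSeries.HasSubst a)
    (hx : MvPowerSeries.constantCoeff x = 0) :
    MvPowerSeries.subst a (chainSeries x y) =
      chainSeries (MvPowerSeries.subst a x) (MvPowerSeries.subst a y) := by
  have h : MvPowerSeries.constantCoeff (1 + x * y) ≠ 0 := by simp [hx]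
  rw [chainSeries, MvPowerSeries.subst_mul ha, subst_inv ha h]
  simp only [← MvPowerSeries.coe_substAlgHom ha, map_neg, map_mul, map_pow, map_add, map_one]
  rfl

theorem subst_serE (ha : MvPowerSeries.HasSubst a) (hx : MvPowerSeries.constantCoeff x = 0) :
    MvPowerSeries.subst a (serE x y) =
      serE (MvPowerSeries.subst a x) (MvPowerSeries.subst a y) := by
  have h : MvPowerSeries.constantCoeff (2 + 2 * x * y) ≠ 0 := by
    simp [hx, map_ofNat (MvPowerSeries.constantCoeff (σ := σ) (R := ℚ)) 2]
  have hxy : MvPowerSeries.constantCoeff (x * y) = 0 := by simp [hx]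
  have h1 := subst_inv ha h
  have h2 := subst_logOneAdd ha hxy
  rw [← MvPowerSeries.coe_substAlgHom ha] at h1 h2 ⊢
  rw [serE, serE]
  simp only [map_sub, map_neg, map_mul, map_pow, map_add, map_smul, h1, h2, map_ofNat]

theorem subst_vertexExponent (ha : MvPowerSeries.HasSubst a)
    (hx : MvPowerSeries.constantCoeff x = 0) (m : MvPowerSeries σ ℚ) :
    MvPowerSeries.subst a (vertexExponent x y m) = vertexExponent (MvPowerSeries.subst a x)
      (MvPowerSeries.subst a y) (MvPowerSeries.subst a m) := by
  have h1 := subst_chainSeries (y := y) ha hx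
  rw [← MvPowerSeries.coe_substAlgHom ha] at h1 ⊢
  rw [vertexExponent, vertexExponent]
  simp only [map_sub, map_neg, map_mul, map_add, map_smul, h1]

theorem subst_closedExponent (ha : MvPowerSeries.HasSubst a)
    (hx : MvPowerSeries.constantCoeff x = 0) (l m : MvPowerSeries σ ℚ) :
    MvPowerSeries.subst a (closedExponent x y l m) = closedExponent (MvPowerSeries.subst a x)
      (MvPowerSeries.subst a y) (MvPowerSeries.subst a l) (MvPowerSeries.subst a m) := by
  have h1 := subst_serE (y := y) ha hx
  rw [← MvPowerSeries.coe_substAlgHom ha] at h1 ⊢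
  rw [closedExponent, closedExponent]
  simp only [map_sub, map_mul, map_pow, map_add, map_smul, h1]

/-- Uses `y + s = y / (1 + x y)` to reach the exponent appearing in `serA`. -/
theorem vertexExponent_zero (hx : MvPowerSeries.constantCoeff x = 0) :
    vertexExponent x y 0 = (x ^ 2 * y ^ 3 - 2 * x * y) * (2 + 2 * x * y)⁻¹ := by
  have h : MvPowerSeries.constantCoeff (2 + 2 * x * y) ≠ 0 := by
    simp [hx, map_ofNat (MvPowerSeries.constantCoeff (σ := σ) (R := ℚ)) 2]
  have h' : MvPowerSeries.constantCoeff (1 + x * y) ≠ 0 := by simp [hx]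
  have hq : (MvPowerSeries.C (1 / 2 : ℚ) : MvPowerSeries σ ℚ) * 2 = 1 := by
    rw [← map_ofNat (MvPowerSeries.C (σ := σ) (R := ℚ)) 2, ← map_mul]
    norm_num
  have h1 := MvPowerSeries.mul_inv_cancel _ h'
  rw [MvPowerSeries.eq_mul_inv_iff_mul_eq h, vertexExponent, chainSeries,
    MvPowerSeries.smul_eq_C_mul]
  generalize (1 + x * y)⁻¹ = u at h1 ⊢
  generalize MvPowerSeries.C (1 / 2 : ℚ) = c at hq ⊢
  grind

theorem closedExponent_zero : closedExponent x y 0 0 = serE x y := by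
  simp [closedExponent]

end

theorem hasSum_subst_multiWeight {τ : Type} {a : Var → MvPowerSeries τ ℚ}
    (ha : MvPowerSeries.HasSubst a) (h : ∀ i : ℕ+, i ≠ 1 → a (Var.y i) = 0) :
    HasSum (fun k => MvPowerSeries.subst a (multiWeight k)) (1 + a (Var.y 1)) := by
  have h0 : MvPowerSeries.subst a (multiWeight 0) = 1 := by rw [multiWeight_zero, subst_one ha]
  have h1 : MvPowerSeries.subst a (multiWeight 1) = a (Var.y 1) := by
    rw [multiWeight_one, varY, MvPowerSeries.subst_X ha]
    rfl
  have h2 : HasSum (fun k => MvPowerSeries.subst a (multiWeight k))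
      (∑ k ∈ Finset.range 2, MvPowerSeries.subst a (multiWeight k)) := by
    refine hasSum_sum_of_ne_finset_zero fun k hk => ?_
    rcases k with _ | _ | k
    · simp at hk
    · simp at hk
    · rw [multiWeight, varY, MvPowerSeries.subst_smul ha, MvPowerSeries.subst_X ha, h, smul_zero]
      intro h
      have := congrArg PNat.val h
      simp at this
  rwa [Finset.sum_range_succ, Finset.sum_range_one, h0, h1] at h2

theorem constantCoeff_simpleSubst (i : Fin 2) :
    MvPowerSeries.constantCoeff (simpleSubst i) = 0 := by
  have hx : MvPowerSeries.constantCoeff (MvPowerSeries.X 0 : MvPowerSeries (Fin 2) ℚ) = 0 :=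
    MvPowerSeries.constantCoeff_X _
  have hy : MvPowerSeries.constantCoeff (MvPowerSeries.X 1 : MvPowerSeries (Fin 2) ℚ) = 0 :=
    MvPowerSeries.constantCoeff_X _
  fin_cases i
  · change MvPowerSeries.constantCoeff (serA _ _) = 0
    rw [serA, map_mul, hx, zero_mul]
  · have h := constantCoeff_expS
      (constantCoeff_eq_zero_of_dvd hx (dvd_chainSeries _ (MvPowerSeries.X 1)))
    rw [chainSeries] at h
    change MvPowerSeries.constantCoeff (serB _ _) = 0
    rw [serB, map_sub, map_mul, map_add, hy, h]
    simp

theorem hasSubst_simpleSubst : MvPowerSeries.HasSubst simpleSubst :=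
  MvPowerSeries.hasSubst_of_constantCoeff_zero constantCoeff_simpleSubst

/-- Specialising the multigraph identity would leave nonzero images of `z` and of the higher `y_k`
inside the connected series. Instead the sum for the exponential of the 3-multigraph series is
projected and compared with the connected one at `x ↦ A`, `y₁ ↦ B`, all other variables zero. -/
theorem threeGraphGF_eq : threeGraphGF = MvPowerSeries.subst simpleSubst connectedGF
    + serE (MvPowerSeries.X 0) (MvPowerSeries.X 1) := by
  have hx : MvPowerSeries.constantCoeff (MvPowerSeries.X 0 : MvPowerSeries (Fin 2) ℚ) = 0 :=
    MvPowerSeries.constantCoeff_X _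
  have hp := hasSubst_simpleProj
  have hY := summable_multiWeight.hasSum
  have hpx : MvPowerSeries.subst simpleProj varX = MvPowerSeries.X 0 := MvPowerSeries.subst_X hp _
  have hpz : MvPowerSeries.subst simpleProj varZ = 0 := MvPowerSeries.subst_X hp _
  have hpy : MvPowerSeries.subst simpleProj (varY 1) = MvPowerSeries.X 1 :=
    (MvPowerSeries.subst_X hp _).trans (by rw [simpleProj, if_pos (by decide)])
  have hpy2 : MvPowerSeries.subst simpleProj (varY 2) = 0 :=
    (MvPowerSeries.subst_X hp _).trans (by rw [simpleProj, if_neg (by decide)])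
  have hpY : MvPowerSeries.subst simpleProj (∑' k, multiWeight k) = 1 + MvPowerSeries.X 1 :=
    (hasSum_mvSubst hp hY).unique
      (hasSum_subst_multiWeight hp fun i hi => by rw [simpleProj, if_neg hi])
  have hpK : MvPowerSeries.subst simpleProj threeMultiGF = threeGraphGF :=
    subst_simpleProj_multiGF 3
  have hpC : MvPowerSeries.subst simpleProj connectedMultiGF = connectedGF :=
    subst_simpleProj_multiGF 0
  have hz : MvPowerSeries.constantCoeff ((1 / 2 : ℚ) • varZ) = 0 := by
    simp [varZ, MvPowerSeries.smul_eq_C_mul]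
  have hv := constantCoeff_eq_zero_of_dvd constantCoeff_varX
    (dvd_vertexExponent varX (varY 1) ((1 / 2 : ℚ) • varY 2))
  have hc := constantCoeff_eq_zero_of_dvd constantCoeff_varX (dvd_closedExponent
    constantCoeff_varX (varY 1) ((1 / 2 : ℚ) • varZ) ((1 / 2 : ℚ) • varY 2))
  obtain ⟨h1, h2⟩ := hasSum_expS_threeMultiGF hY
  have h1' : MvPowerSeries.constantCoeff threeGraphGF = 0 := by
    rw [← hpK]
    exact MvPowerSeries.constantCoeff_subst_eq_zero hp constantCoeff_simpleProj h1
  have h3 := hasSum_mvSubst hp h2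
  rw [subst_expS hp (by rw [map_sub, h1, hc, sub_zero]), MvPowerSeries.subst_sub hp, hpK,
    subst_closedExponent hp constantCoeff_varX, MvPowerSeries.subst_smul hp,
    MvPowerSeries.subst_smul hp, hpx, hpz, hpy, hpy2, smul_zero, closedExponent_zero] at h3
  have hc0 : ∀ i,
      MvPowerSeries.constantCoeff (MvPowerSeries.subst simpleSubst (simpleProj i)) = 0 :=
    fun i => MvPowerSeries.constantCoeff_subst_eq_zero hasSubst_simpleSubst
      constantCoeff_simpleSubst (constantCoeff_simpleProj i)
  -- Projection followed by `simpleSubst`, as one substitution, makes `hasSum_expS_subst` applicable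
  -- to simple graphs.
  have hs : MvPowerSeries.HasSubst fun v => MvPowerSeries.subst simpleSubst (simpleProj v) := by
    have h := hp.comp hasSubst_simpleSubst
    rwa [MvPowerSeries.coe_substAlgHom] at h
  have hsx : MvPowerSeries.subst simpleSubst (simpleProj Var.x) = simpleSubst 0 :=
    MvPowerSeries.subst_X hasSubst_simpleSubst _
  have hs0 : MvPowerSeries.subst simpleSubst (0 : MvPowerSeries (Fin 2) ℚ) = 0 := by
    rw [← MvPowerSeries.coe_substAlgHom hasSubst_simpleSubst, map_zero]
  have hsz : MvPowerSeries.subst simpleSubst (simpleProj Var.z) = 0 := hs0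
  have hsy : MvPowerSeries.subst simpleSubst (simpleProj (Var.y 1)) = simpleSubst 1 := by
    rw [simpleProj, if_pos rfl]
    exact MvPowerSeries.subst_X hasSubst_simpleSubst _
  obtain ⟨h4, h5⟩ := hasSum_expS_subst hs hc0 (hasSum_subst_multiWeight hs fun i hi => by
    rw [simpleProj, if_neg hi, hs0])
  rw [← MvPowerSeries.subst_comp_subst_apply hp hasSubst_simpleSubst, hpC] at h4 h5
  rw [hsx, hsz, hsy, smul_zero, expS_zero, mul_one] at h5
  have h6 := expS_injective (by
    rw [map_sub, h1', constantCoeff_eq_zero_of_dvd hx (dvd_serE hx _), sub_zero]) h4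
    (h3.unique (h5.congr_fun fun n => ?_))
  · rw [← h6, sub_add_cancel]
  -- Termwise match: `A` is `x` times the exponential of the vertex part, and `1 + B = (1 + y) exp
  -- s`.
  · have hA : simpleSubst 0 = MvPowerSeries.X 0 * expS (vertexExponent (MvPowerSeries.X 0)
        (MvPowerSeries.X 1) 0) := by
      rw [vertexExponent_zero hx]
      rfl
    have hB : 1 + simpleSubst 1 = (1 + MvPowerSeries.X 1) *
        expS (chainSeries (MvPowerSeries.X 0) (MvPowerSeries.X 1)) := by
      change 1 + serB _ _ = _
      rw [serB, chainSeries]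
      ring
    rw [hA, hB, MvPowerSeries.subst_smul hp, MvPowerSeries.subst_mul hp,
      MvPowerSeries.subst_pow hp, MvPowerSeries.subst_pow hp, MvPowerSeries.subst_mul hp,
      MvPowerSeries.subst_mul hp, MvPowerSeries.subst_mul hp, subst_expS hp hz, subst_expS hp hv,
      subst_expS hp constantCoeff_serS, MvPowerSeries.subst_smul hp, hpz, smul_zero, expS_zero,
      one_mul, subst_vertexExponent hp constantCoeff_varX, hpx, hpy, MvPowerSeries.subst_smul hp,
      hpy2, smul_zero, hpY, serS_eq_chainSeries, subst_chainSeries hp constantCoeff_varX, hpx, hpy]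

end KernelEGF

theorem mainTheorem10 :
    (MvPowerSeries.HasSubst KernelEGF.kernelSubst ∧
      KernelEGF.threeMultiGF =
        MvPowerSeries.subst KernelEGF.kernelSubst KernelEGF.connectedMultiGF
          + KernelEGF.serE KernelEGF.varX (KernelEGF.varY 1)
          - (1 / 2 : ℚ) • (KernelEGF.varX * KernelEGF.varZ)
          + (1 / 4 : ℚ) • (KernelEGF.varX ^ 2 * KernelEGF.varY 2)) ∧
    (MvPowerSeries.HasSubst KernelEGF.simpleSubst ∧
      KernelEGF.threeGraphGF =
        MvPowerSeries.subst KernelEGF.simpleSubst KernelEGF.connectedGF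
          + KernelEGF.serE (MvPowerSeries.X 0) (MvPowerSeries.X 1)) :=
  ⟨⟨KernelEGF.hasSubst_kernelSubst, KernelEGF.threeMultiGF_eq⟩,
    KernelEGF.hasSubst_simpleSubst, KernelEGF.threeGraphGF_eq⟩
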